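/- Let $\gamma\in(0,1)$ and $g(x)=x^\gamma$. For $A\ge 1$ let $\mathcal D=\mathcal D_A=\{(x,y)\in\mathbb R^2: x>A,\ |y|<g(x)\}$. Let $\alpha$ be a random angle for which there is $\bar\alpha\in(0,\pi/2)$ with $$\mathbf P[|\alpha|<\bar\alpha]=1,\qquad \mathbf P[\alpha\ge x]=\mathbf P[\alpha\le -x]\quad(x\in\mathbb R),$$ and let $(\alpha_k)_{k\ge 0}$ be i.i.d. copies of $\alpha$. The collisions process $\xi=(\xi_n)_{n\ge 0}$, with values in $\partial\mathcal D\cup\{\underline\infty\}$, is defined as follows from a deterministic starting point $\xi_0\in\partial\mathcal D$ with first coordinate $\xi_0^{(1)}>2A$. Given $\xi_k\ne\underline\infty$, let $\Gamma_k$ be the ray from $\xi_k$ at angle $\alpha_k$ to the interior normal to $\partial\mathcal D$ at $\xi_k$ (positive angles are to the right, i.e. towards increasing $x$, and negative angles to the left). If $\Gamma_k$ does not meet $\partial\mathcal D\setminus\{\xi_k\}$, set $\xi_{k+1}=\underline\infty$. Otherwise let $(x_k,y_k)$ be the first point where $\Gamma_k$ meets $\partial\mathcal D$ after leaving $\xi_k$;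 set $\xi_{k+1}=(2A,g(2A))$ if $x_k=A$, and $\xi_{k+1}=(x_k,y_k)$ otherwise. If $\xi_k=\underline\infty$, set $\xi_{k+1}=\underline\infty$. Put $$\gamma_c=\frac{\mathbf E[\tan^2\alpha]}{1+2\,\mathbf E[\tan^2\alpha]}.$$ Theorem. There is $A_0\ge 1$, depending only on $\gamma$ and the law of $\alpha$, such that for every $A>A_0$ and every $\xi_0\in\partial\mathcal D$ with $\xi_0^{(1)}>2A$: almost surely $\xi_n\ne\underline\infty$ for all $n$; for every $\varepsilon>0$, a.s., for all but finitely many $n$, $$n^{\frac1{2(1-\gamma)}}(\log n)^{-\frac1{2(1-\gamma)}-\varepsilon}\ \le\ \max_{0\le m\le n}\xi^{(1)}_m\ \le\ n^{\frac1{2(1-\gamma)}}(\log n)^{\frac1{2(1-\gamma)}+\varepsilon};$$ and, if moreover $\gamma>\gamma_c$, then there is $D\in(0,\infty)$ such that, a.s., for all but finitely many $n$, $$\xi^{(1)}_n\ \ge\ n^{\frac1{2(1-\gamma)}}(\log n)^{-D}.$$ -/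

import Mathlib

open MeasureTheory ProbabilityTheory Filter Topology

noncomputable section

namespace StochasticBilliard

/-- The tube `{(x, y) : x > A, |y| < g x}`. -/
def tube (g : ℝ → ℝ) (A : ℝ) : Set (ℝ × ℝ) :=
  {p | A < p.1 ∧ |p.2| < g p.1}

/-- The interior unit normal at a point `p = (x, ±g x)` of the curved boundary (`x > A`): it is
proportional to `(g' x, -1)` on the upper curve and to `(g' x, 1)` on the lower curve. -/
def innerNormal (g : ℝ → ℝ) (p : ℝ × ℝ) : ℝ × ℝ :=
  (Real.sqrt (1 + deriv g p.1 ^ 2))⁻¹ • (deriv g p.1, if 0 < p.2 then -1 else 1)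

/-- The unit tangent at a point `p = (x, ±g x)` of the curved boundary that points to the right
(towards increasing `x`): it is proportional to `(1, g' x)` on the upper curve and to
`(1, -g' x)` on the lower curve. -/
def rightTangent (g : ℝ → ℝ) (p : ℝ × ℝ) : ℝ × ℝ :=
  (Real.sqrt (1 + deriv g p.1 ^ 2))⁻¹ • (1, if 0 < p.2 then deriv g p.1 else -deriv g p.1)

/-- The direction of the ray that leaves `p` at angle `a` to the interior normal; positive angles
are to the right of the normal, negative angles to the left. -/
def rayDirection (g : ℝ → ℝ) (p : ℝ × ℝ) (a : ℝ) : ℝ × ℝ :=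
  Real.cos a • innerNormal g p + Real.sin a • rightTangent g p

/-- `q` is the first point of `S` on the ray `{p + t v : t > 0}`. -/
def IsFirstHit (S : Set (ℝ × ℝ)) (p v q : ℝ × ℝ) : Prop :=
  ∃ t : ℝ, 0 < t ∧ q = p + t • v ∧ q ∈ S ∧ ∀ s : ℝ, 0 < s → s < t → p + s • v ∉ S

theorem IsFirstHit.unique {S : Set (ℝ × ℝ)} {p v q q' : ℝ × ℝ}
    (h : IsFirstHit S p v q) (h' : IsFirstHit S p v q') : q = q' := by
  obtain ⟨t, ht, rfl, hS, hm⟩ := h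
  obtain ⟨t', ht', rfl, hS', hm'⟩ := h'
  rcases lt_trichotomy t t' with hlt | rfl | hlt
  · exact absurd hS (hm' t ht hlt)
  · rfl
  · exact absurd hS' (hm t' ht' hlt)

open scoped Classical in
/-- One step of the collisions process from the boundary point `p` with reflection angle `a`.
The value `none` stands for the absorbing state at infinity. A ray whose first hit has first
coordinate `A` is sent to the point `(2A, g(2A))`. -/
def step (g : ℝ → ℝ) (A : ℝ) (p : ℝ × ℝ) (a : ℝ) : Option (ℝ × ℝ) :=
  if h : ∃ q, IsFirstHit (frontier (tube g A)) p (rayDirection g p a) q then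
    if h.choose.1 = A then some (2 * A, g (2 * A)) else some h.choose
  else none

/-- The collisions process started at `p₀` and driven by the sequence of reflection angles `a`;
`none` is the absorbing state at infinity. -/
def collisions (g : ℝ → ℝ) (A : ℝ) (p₀ : ℝ × ℝ) (a : ℕ → ℝ) : ℕ → Option (ℝ × ℝ)
  | 0 => some p₀
  | k + 1 => (collisions g A p₀ a k).bind fun p => step g A p (a k)

/-- The first coordinate of a state (with the dummy value `0` for the state at infinity). -/
def horizontal : Option (ℝ × ℝ) → ℝ
  | none => 0
  | some p => p.1

/-- `runningMax u n = max (u 0, …, u n)`. -/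
def runningMax (u : ℕ → ℝ) (n : ℕ) : ℝ :=
  (Finset.range (n + 1)).sup' Finset.nonempty_range_add_one u

/-- `E[tan² α]` for a random angle `α` with law `μ`. -/
def tanSqMean (μ : Measure ℝ) : ℝ :=
  ∫ a, Real.tan a ^ 2 ∂μ

/-- The critical exponent `E[tan² α] / (1 + 2 E[tan² α])`. -/
def criticalExponent (μ : Measure ℝ) : ℝ :=
  tanSqMean μ / (1 + 2 * tanSqMean μ)

end StochasticBilliard

end

/-! The tube is symmetric and scales well, so the first coordinate of the collisions is itself a
Markov chain. Put `κ = x ^ (γ - 1)` and `T = tan a`. A ray leaving above `x` at angle `a` meets the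
opposite curve above `x (1 + u)`, where `u / (1 + (1 + u) ^ γ) = v` and `v = κ (T + γ κ) / (1 - γ κ
T)`. Expanding `(1 + u) ^ p` to second order in the small `κ` and averaging removes the term linear
in `T`, because the law of the angle is symmetric. The power `x ^ p` therefore has drift `x ^ p κ² ·
driftCoeff`, up to a relative error `O(κ³)` (`integral_landing_rpow`).

Two exponents matter. For `p = 2 (1 - γ)` one has `x ^ p κ² = 1`, so `x ^ p` gains a bounded
positive amount per step in mean. Markov's inequality for the chain stopped at a level bounds its
maximum from above (`measure_exists_le_rpow`); the same drift bounds the mean time needed to reach a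
level, hence the maximum from below (`measure_forall_rpow_lt`). For `p = -δ` with `δ` small the
drift is negative exactly when `γ` exceeds the critical exponent. Then `x ^ (-δ)` is a
supermartingale, and after reaching `y` the chain ever falls below `z` with probability at most `(z
/ y) ^ δ` (`measure_exists_drop`). Borel–Cantelli along the times `2 ^ k` gives the almost sure
bounds.

The geometric input is `step_eq`: by concavity of `x ^ γ` the chord between the two curves stays
inside the tube, so the ray stops at its far end or at the wall `x = A`, whichever comes first. -/

noncomputable section

namespace StochasticBilliard

open Asymptotics Set

/-! ### The intersection equation in scale-invariant form -/

/-- If a ray leaves the boundary point above `x` and reaches the opposite boundary curve above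
`x (1 + u)`, then `slopeRatio γ u` is a quantity that depends only on the direction of the ray. -/
def slopeRatio (γ u : ℝ) : ℝ := u / (1 + (1 + u) ^ γ)

/-- The inverse of `slopeRatio γ`, clipped to `[-1/2, 1/2]`. -/
def relJump (γ v : ℝ) : ℝ :=
  sSup (insert (-(1 / 2)) {u ∈ Icc (-(1 / 2) : ℝ) (1 / 2) | slopeRatio γ u ≤ v})

theorem bddAbove_relJump_set (γ v : ℝ) :
    BddAbove (insert (-(1 / 2) : ℝ) {u ∈ Icc (-(1 / 2) : ℝ) (1 / 2) | slopeRatio γ u ≤ v}) :=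
  ⟨1 / 2, by rintro u (rfl | hu); · norm_num
             · exact hu.1.2⟩

theorem relJump_mem (γ v : ℝ) : relJump γ v ∈ Icc (-(1 / 2) : ℝ) (1 / 2) := by
  refine ⟨le_csSup (bddAbove_relJump_set γ v) (mem_insert _ _), csSup_le (insert_nonempty _ _) ?_⟩
  rintro u (rfl | hu)
  · norm_num
  · exact hu.1.2

theorem relJump_mono (γ : ℝ) : Monotone (relJump γ) := fun _ w hvw =>
  csSup_le_csSup (bddAbove_relJump_set γ w) (insert_nonempty _ _)
    (insert_subset_insert fun _ hu => ⟨hu.1, hu.2.trans hvw⟩)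

theorem measurable_relJump (γ : ℝ) : Measurable (relJump γ) := (relJump_mono γ).measurable

/-- Since `γ < 1`, `(1 + u) ^ γ / (1 + u)` decreases, so the denominator grows more slowly than the
numerator can compensate. This is only needed when both points are positive; otherwise signs
suffice. -/
theorem slopeRatio_strictMonoOn {γ : ℝ} (h₀ : 0 < γ) (h₁ : γ < 1) :
    StrictMonoOn (slopeRatio γ) (Ioi (-1)) := by
  intro u hu w hw huw
  simp only [mem_Ioi] at hu hw
  have hu' : 0 < 1 + u := by linarith
  have hw' : 0 < 1 + w := by linarith
  have pu : 0 < (1 + u) ^ γ := Real.rpow_pos_of_pos hu' _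
  have pw : 0 < (1 + w) ^ γ := Real.rpow_pos_of_pos hw' _
  have hlt : (1 + u) ^ γ < (1 + w) ^ γ := Real.rpow_lt_rpow hu'.le (by linarith) h₀
  unfold slopeRatio
  rw [div_lt_div_iff₀ (by linarith) (by linarith)]
  rcases le_or_gt w 0 with hw0 | hw0
  · nlinarith
  rcases le_or_gt u 0 with hu0 | hu0
  · nlinarith
  have key : (1 + w) ^ γ * (1 + u) ≤ (1 + u) ^ γ * (1 + w) := by
    have e1 : (1 + u) = (1 + u) ^ γ * (1 + u) ^ (1 - γ) := by
      rw [← Real.rpow_add hu']; simp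
    have e2 : (1 + w) = (1 + w) ^ γ * (1 + w) ^ (1 - γ) := by
      rw [← Real.rpow_add hw']; simp
    have h3 : (1 + u) ^ (1 - γ) ≤ (1 + w) ^ (1 - γ) :=
      Real.rpow_le_rpow hu'.le (by linarith) (by linarith)
    calc (1 + w) ^ γ * (1 + u) = (1 + w) ^ γ * ((1 + u) ^ γ * (1 + u) ^ (1 - γ)) := by rw [← e1]
      _ ≤ (1 + w) ^ γ * ((1 + u) ^ γ * (1 + w) ^ (1 - γ)) := by gcongr
      _ = (1 + u) ^ γ * ((1 + w) ^ γ * (1 + w) ^ (1 - γ)) := by ring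
      _ = _ := by rw [← e2]
  nlinarith

/-- Intermediate value theorem: `slopeRatio` is at most `-1/4` at `-1/2` and at least `1/5` at
`1/2`, so its range there contains `[-1/6, 1/6]` and the clipping is inactive. -/
theorem slopeRatio_relJump {γ : ℝ} (h₀ : 0 < γ) (h₁ : γ < 1) {v : ℝ} (hv : |v| ≤ 1 / 6) :
    slopeRatio γ (relJump γ v) = v := by
  have hcont : ContinuousOn (slopeRatio γ) (Icc (-(1 / 2)) (1 / 2)) := by
    unfold slopeRatio
    refine continuousOn_id.div (continuousOn_const.add ((continuousOn_const.add
      continuousOn_id).rpow_const fun u _ => Or.inr h₀.le)) fun u hu => ?_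
    have : 0 ≤ (1 + u) ^ γ := Real.rpow_nonneg (by linarith [hu.1]) _
    positivity
  have hlow : slopeRatio γ (-(1 / 2)) ≤ v := by
    have h1 : (1 + -(1 / 2) : ℝ) ^ γ ≤ 1 := Real.rpow_le_one (by norm_num) (by norm_num) h₀.le
    have h2 : (0 : ℝ) < (1 + -(1 / 2) : ℝ) ^ γ := Real.rpow_pos_of_pos (by norm_num) _
    unfold slopeRatio
    rw [div_le_iff₀ (by linarith)]
    nlinarith [(abs_le.1 hv).1]
  have hhigh : v ≤ slopeRatio γ (1 / 2) := by
    have h1 : (1 + 1 / 2 : ℝ) ^ γ ≤ (1 + 1 / 2 : ℝ) ^ (1 : ℝ) :=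
      Real.rpow_le_rpow_of_exponent_le (by norm_num) h₁.le
    have h2 : (0 : ℝ) < (1 + 1 / 2 : ℝ) ^ γ := Real.rpow_pos_of_pos (by norm_num) _
    rw [Real.rpow_one] at h1
    unfold slopeRatio
    rw [le_div_iff₀ (by linarith)]
    nlinarith [(abs_le.1 hv).2]
  obtain ⟨u, hu, rfl⟩ := intermediate_value_Icc (by norm_num) hcont ⟨hlow, hhigh⟩
  congr 1
  refine le_antisymm (csSup_le (insert_nonempty _ _) ?_)
    (le_csSup (bddAbove_relJump_set _ _) (mem_insert_of_mem _ ⟨hu, le_rfl⟩))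
  rintro w (rfl | hw)
  · exact hu.1
  · exact ((slopeRatio_strictMonoOn h₀ h₁).le_iff_le (by simp only [mem_Ioi]; linarith [hw.1.1])
      (by simp only [mem_Ioi]; linarith [hu.1])).1 hw.2

theorem relJump_eq {γ : ℝ} (h₀ : 0 < γ) (h₁ : γ < 1) {v : ℝ} (hv : |v| ≤ 1 / 6) :
    relJump γ v = v * (1 + (1 + relJump γ v) ^ γ) := by
  have h := slopeRatio_relJump h₀ h₁ hv
  have h2 : 0 < (1 + relJump γ v) ^ γ :=
    Real.rpow_pos_of_pos (by linarith [(relJump_mem γ v).1]) _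
  unfold slopeRatio at h
  rwa [div_eq_iff (by linarith)] at h

theorem abs_relJump_le {γ : ℝ} (h₀ : 0 < γ) (h₁ : γ < 1) {v : ℝ} (hv : |v| ≤ 1 / 6) :
    |relJump γ v| ≤ 3 * |v| := by
  have hm := relJump_mem γ v
  have h2 : 0 < (1 + relJump γ v) ^ γ := Real.rpow_pos_of_pos (by linarith [hm.1]) _
  have h3 : (1 + relJump γ v) ^ γ ≤ 2 := by
    calc (1 + relJump γ v) ^ γ ≤ (2 : ℝ) ^ γ :=
          Real.rpow_le_rpow (by linarith [hm.1]) (by linarith [hm.2]) h₀.le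
      _ ≤ (2 : ℝ) ^ (1 : ℝ) := Real.rpow_le_rpow_of_exponent_le (by norm_num) h₁.le
      _ = 2 := Real.rpow_one _
  rw [relJump_eq h₀ h₁ hv, abs_mul, abs_of_pos (by linarith : 0 < 1 + (1 + relJump γ v) ^ γ)]
  nlinarith [abs_nonneg v]

theorem relJump_isBigO {γ : ℝ} (h₀ : 0 < γ) (h₁ : γ < 1) :
    relJump γ =O[𝓝 0] (fun v : ℝ => v) := by
  refine IsBigO.of_bound 3 ?_
  have : ∀ᶠ v : ℝ in 𝓝 0, |v| ≤ 1 / 6 := by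
    have := (continuous_abs (G := ℝ)).tendsto 0
    rw [abs_zero] at this
    exact this.eventually_le_const (by norm_num)
  filter_upwards [this] with v hv using abs_relJump_le h₀ h₁ hv

/-! ### Second-order expansions -/

theorem one_add_rpow_isBigO (p : ℝ) :
    (fun u : ℝ => (1 + u) ^ p - (1 + p * u + p * (p - 1) / 2 * u ^ 2)) =O[𝓝 0]
      (fun u : ℝ => u ^ 3) := by
  have h := (Real.one_add_rpow_hasFPowerSeriesAt_zero (a := p)).isBigO_sub_partialSum_pow 3
  have hc : Ring.choose p 2 = p * (p - 1) / 2 := by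
    rw [Ring.choose_eq_smul]
    simp [descPochhammer_succ_right, Polynomial.smeval_mul, Polynomial.smeval_sub, Polynomial.smeval_X]
    ring
  refine (h.congr_left fun u => ?_).trans (IsBigO.of_norm_left ?_)
  · simp [FormalMultilinearSeries.partialSum, Finset.sum_range_succ, binomialSeries, hc]
    ring
  · simp only [norm_pow, norm_norm]
    exact (isBigO_refl (fun u : ℝ => u ^ 3) _).norm_left.congr_left fun u => by simp

/-- Bootstrap on the fixed-point equation `u = v (1 + (1 + u) ^ γ)`: from `u = O(v)` to `u = 2 v +
O(v²)` to `u = 2 v + 2 γ v² + O(v³)`, then substitution into the binomial expansion. -/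
theorem one_add_relJump_rpow_isBigO {γ : ℝ} (h₀ : 0 < γ) (h₁ : γ < 1) (p : ℝ) :
    (fun v : ℝ => (1 + relJump γ v) ^ p -
      (1 + 2 * p * v + (2 * p * γ + 2 * p * (p - 1)) * v ^ 2)) =O[𝓝 0] (fun v : ℝ => v ^ 3) := by
  have hu := relJump_isBigO h₀ h₁
  have hu0 : Tendsto (relJump γ) (𝓝 0) (𝓝 0) := hu.trans_tendsto tendsto_id
  have hid : (fun v : ℝ => v) =O[𝓝 0] (fun v : ℝ => v) := isBigO_refl _ _
  have hone : (fun v : ℝ => v) =O[𝓝 0] (fun _ : ℝ => (1 : ℝ)) := (tendsto_id (α := ℝ)).isBigO_one ℝ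
  have hsmall : ∀ᶠ v : ℝ in 𝓝 0, |v| ≤ 1 / 6 := by
    have := (continuous_abs (G := ℝ)).tendsto 0
    rw [abs_zero] at this
    exact this.eventually_le_const (by norm_num)
  have e2 : (fun v => (1 + relJump γ v) ^ γ - (1 + γ * relJump γ v)) =O[𝓝 0]
      (fun v : ℝ => v ^ 2) := by
    have h := (one_add_rpow_isBigO γ).comp_tendsto hu0
    have h3 : (fun v => (relJump γ v) ^ 3) =O[𝓝 0] (fun v : ℝ => v ^ 2) := by
      refine (hu.pow 3).trans ?_
      simpa [pow_succ] using (hid.pow 2).mul hone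
    have h2 : (fun v => γ * (γ - 1) / 2 * relJump γ v ^ 2) =O[𝓝 0] (fun v : ℝ => v ^ 2) :=
      (hu.pow 2).const_mul_left _
    refine ((h.trans h3).add h2).congr_left fun v => ?_
    simp only [Function.comp]; ring
  have e1 : (fun v => relJump γ v - 2 * v) =O[𝓝 0] (fun v : ℝ => v ^ 2) := by
    have h2 : (fun v => γ * (v * relJump γ v)) =O[𝓝 0] (fun v : ℝ => v ^ 2) :=
      ((hid.mul hu).const_mul_left γ).congr_right fun v => by ring
    have h3 : (fun v => v * ((1 + relJump γ v) ^ γ - (1 + γ * relJump γ v))) =O[𝓝 0]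
        (fun v : ℝ => v ^ 2) := (hone.mul e2).congr_right fun v => by ring
    refine (h2.add h3).congr' ?_ EventuallyEq.rfl
    filter_upwards [hsmall] with v hv
    have := relJump_eq h₀ h₁ hv
    linear_combination -this
  have e3 : (fun v => relJump γ v - (2 * v + 2 * γ * v ^ 2)) =O[𝓝 0] (fun v : ℝ => v ^ 3) := by
    have h2 : (fun v => γ * (v * (relJump γ v - 2 * v))) =O[𝓝 0] (fun v : ℝ => v ^ 3) :=
      ((hid.mul e1).const_mul_left γ).congr_right fun v => by ring
    have h3 : (fun v => v * ((1 + relJump γ v) ^ γ - (1 + γ * relJump γ v))) =O[𝓝 0]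
        (fun v : ℝ => v ^ 3) := (hid.mul e2).congr_right fun v => by ring
    refine (h2.add h3).congr' ?_ EventuallyEq.rfl
    filter_upwards [hsmall] with v hv
    have := relJump_eq h₀ h₁ hv
    linear_combination -this
  have esq : (fun v => p * (p - 1) / 2 * ((relJump γ v - 2 * v) * (relJump γ v + 2 * v))) =O[𝓝 0]
      (fun v : ℝ => v ^ 3) :=
    ((e1.mul (hu.add (hid.const_mul_left 2))).const_mul_left _).congr_right fun v => by ring
  have h := ((one_add_rpow_isBigO p).comp_tendsto hu0).trans (hu.pow 3)
  refine ((h.add (e3.const_mul_left p)).add esq).congr_left fun v => ?_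
  simp only [Function.comp]; ring

/-- The direction parameter of the ray leaving the boundary at a point with `g x / x = κ`, in
the direction whose tangent with respect to the normal is `T`. -/
def dirParam (γ κ T : ℝ) : ℝ := κ * (T + γ * κ) / (1 - γ * κ * T)

/-- The remainder after second order is exactly `γ² κ³ T (1 + T²) / (1 - γ κ T)`. The choice `κ₀ = 1
/ (1 + 2 T₀)` forces `κ ≤ 1` and `|γ κ T| ≤ 1/2`, so the denominator is at least `1/2`. -/
theorem dirParam_expansion {γ : ℝ} (h₀ : 0 < γ) (h₁ : γ < 1) {T₀ : ℝ} (hT₀ : 0 < T₀) :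
    ∃ C κ₀ : ℝ, 0 < C ∧ 0 < κ₀ ∧ ∀ κ T : ℝ, 0 < κ → κ ≤ κ₀ → |T| ≤ T₀ →
      1 / 2 ≤ 1 - γ * κ * T ∧ |dirParam γ κ T| ≤ C * κ ∧
      |dirParam γ κ T - (κ * T + γ * κ ^ 2 * (1 + T ^ 2))| ≤ C * κ ^ 3 ∧
      |dirParam γ κ T ^ 2 - κ ^ 2 * T ^ 2| ≤ C * κ ^ 3 := by
  have hM : 1 ≤ 1 + T₀ := by linarith
  refine ⟨9 * (1 + T₀) ^ 4, 1 / (1 + 2 * T₀), by positivity, by positivity,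
    fun κ T hκ hκ' hT => ?_⟩
  rw [le_div_iff₀ (by positivity)] at hκ'
  have hκ1 : κ ≤ 1 := by nlinarith
  have hγT : |γ * κ * T| ≤ 1 / 2 := by
    rw [abs_mul, abs_of_pos (by positivity)]
    calc γ * κ * |T| ≤ 1 * κ * T₀ := by gcongr
      _ ≤ 1 / 2 := by linarith
  have hden : 1 / 2 ≤ 1 - γ * κ * T := by linarith [(abs_le.1 hγT).2]
  have hinv : 0 < (1 - γ * κ * T)⁻¹ ∧ (1 - γ * κ * T)⁻¹ ≤ 2 :=
    ⟨inv_pos.2 (by linarith), by rw [inv_le_comm₀ (by linarith) (by norm_num)]; linarith⟩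
  have hT2 : 1 + T ^ 2 ≤ (1 + T₀) ^ 2 := by nlinarith [sq_abs T, abs_nonneg T]
  have hM14 : 1 + T₀ ≤ (1 + T₀) ^ 4 := le_self_pow₀ hM (by norm_num)
  have hM24 : (1 + T₀) ^ 2 ≤ (1 + T₀) ^ 4 := pow_le_pow_right₀ hM (by norm_num)
  have hM23 : (1 + T₀) ^ 2 ≤ (1 + T₀) ^ 3 := pow_le_pow_right₀ hM (by norm_num)
  have hM34 : (1 + T₀) ^ 3 ≤ (1 + T₀) ^ 4 := pow_le_pow_right₀ hM (by norm_num)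
  have hv : |dirParam γ κ T| ≤ 2 * (1 + T₀) * κ := by
    unfold dirParam
    rw [div_eq_mul_inv, abs_mul, abs_mul, abs_of_pos hκ, abs_of_pos hinv.1]
    have : |T + γ * κ| ≤ 1 + T₀ := by
      refine (abs_add_le _ _).trans ?_
      rw [abs_of_pos (by positivity : 0 < γ * κ)]
      nlinarith
    calc κ * |T + γ * κ| * (1 - γ * κ * T)⁻¹ ≤ κ * (1 + T₀) * 2 := by
          gcongr
          exact hinv.2
      _ = _ := by ring
  have hR : |dirParam γ κ T - (κ * T + γ * κ ^ 2 * (1 + T ^ 2))| ≤ 2 * (1 + T₀) ^ 3 * κ ^ 3 := by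
    have e : dirParam γ κ T - (κ * T + γ * κ ^ 2 * (1 + T ^ 2)) =
        γ ^ 2 * κ ^ 3 * T * (1 + T ^ 2) * (1 - γ * κ * T)⁻¹ := by
      unfold dirParam
      have hi : (1 - γ * κ * T) * (1 - γ * κ * T)⁻¹ = 1 := mul_inv_cancel₀ (by linarith)
      rw [div_eq_mul_inv]
      linear_combination (κ * T + γ * κ ^ 2 * (1 + T ^ 2)) * hi
    rw [e, abs_mul, abs_mul, abs_mul, abs_of_pos hinv.1, abs_of_pos (by positivity : 0 < 1 + T ^ 2),
      abs_of_pos (by positivity : 0 < γ ^ 2 * κ ^ 3)]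
    have hg2 : γ ^ 2 ≤ 1 := pow_le_one₀ h₀.le h₁.le
    calc γ ^ 2 * κ ^ 3 * |T| * (1 + T ^ 2) * (1 - γ * κ * T)⁻¹
        ≤ 1 * κ ^ 3 * (1 + T₀) * (1 + T₀) ^ 2 * 2 := by
          gcongr
          · linarith
          · exact hinv.2
      _ = _ := by ring
  refine ⟨hden, hv.trans ?_, hR.trans ?_, ?_⟩
  · gcongr
    nlinarith
  · gcongr
    nlinarith
  have hd : |dirParam γ κ T - κ * T| ≤ 3 * (1 + T₀) ^ 3 * κ ^ 2 := by
    have e : dirParam γ κ T - κ * T =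
      (dirParam γ κ T - (κ * T + γ * κ ^ 2 * (1 + T ^ 2))) + γ * κ ^ 2 * (1 + T ^ 2) := by ring
    rw [e]
    refine (abs_add_le _ _).trans ?_
    rw [abs_of_pos (by positivity : 0 < γ * κ ^ 2 * (1 + T ^ 2))]
    have h1 : γ * κ ^ 2 * (1 + T ^ 2) ≤ 1 * κ ^ 2 * (1 + T₀) ^ 3 := by
      gcongr
      linarith
    have h2 : 2 * (1 + T₀) ^ 3 * κ ^ 3 ≤ 2 * (1 + T₀) ^ 3 * κ ^ 2 := by
      gcongr 2 * (1 + T₀) ^ 3 * ?_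
      exact pow_le_pow_of_le_one hκ.le hκ1 (by norm_num)
    linarith
  have hs : |dirParam γ κ T + κ * T| ≤ 3 * (1 + T₀) * κ := by
    refine (abs_add_le _ _).trans ?_
    rw [abs_mul κ, abs_of_pos hκ]
    nlinarith
  have e : dirParam γ κ T ^ 2 - κ ^ 2 * T ^ 2 =
    (dirParam γ κ T - κ * T) * (dirParam γ κ T + κ * T) := by ring
  rw [e, abs_mul]
  calc _ ≤ (3 * (1 + T₀) ^ 3 * κ ^ 2) * (3 * (1 + T₀) * κ) := by gcongr
    _ = _ := by ring

/-- Uniform second-order expansion of a power of the relative position after a virtual step. -/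
theorem jump_rpow_expansion {γ : ℝ} (h₀ : 0 < γ) (h₁ : γ < 1) {T₀ : ℝ} (hT₀ : 0 < T₀) (p : ℝ) :
    ∃ C κ₀ : ℝ, 0 < C ∧ 0 < κ₀ ∧ ∀ κ T : ℝ, 0 < κ → κ ≤ κ₀ → |T| ≤ T₀ →
      |(1 + relJump γ (dirParam γ κ T)) ^ p - (1 + 2 * p * κ * T +
        κ ^ 2 * (2 * p * γ * (1 + 2 * T ^ 2) + 2 * p * (p - 1) * T ^ 2))| ≤ C * κ ^ 3 := by
  obtain ⟨C, κ₀, hC, hκ₀, hd⟩ := dirParam_expansion h₀ h₁ hT₀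
  obtain ⟨K, hK, hb⟩ := (one_add_relJump_rpow_isBigO h₀ h₁ p).exists_pos
  obtain ⟨r, hr, hball⟩ := Metric.eventually_nhds_iff.1 hb.bound
  simp only [dist_zero_right, Real.norm_eq_abs] at hball
  -- The bound `κ ≤ r / (2 C)` puts `|v| ≤ C κ` inside the radius `r` where the local expansion is
  -- valid.
  refine ⟨K * C ^ 3 + |2 * p| * C + |2 * p * γ + 2 * p * (p - 1)| * C, min κ₀ (r / (2 * C)),
    by positivity, by positivity, fun κ T hκ hκ' hT => ?_⟩
  obtain ⟨-, h1, h2, h3⟩ := hd κ T hκ (hκ'.trans (min_le_left _ _)) hT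
  have hκr : κ ≤ r / (2 * C) := hκ'.trans (min_le_right _ _)
  rw [le_div_iff₀ (by positivity)] at hκr
  set v := dirParam γ κ T
  have hvr : |v| < r := by nlinarith
  have h4 := hball hvr
  have h5 : K * |v ^ 3| ≤ K * C ^ 3 * κ ^ 3 := by
    rw [abs_pow, mul_assoc, ← mul_pow]
    gcongr
  have e : (1 + relJump γ v) ^ p - (1 + 2 * p * κ * T +
        κ ^ 2 * (2 * p * γ * (1 + 2 * T ^ 2) + 2 * p * (p - 1) * T ^ 2)) =
      ((1 + relJump γ v) ^ p - (1 + 2 * p * v + (2 * p * γ + 2 * p * (p - 1)) * v ^ 2)) +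
      2 * p * (v - (κ * T + γ * κ ^ 2 * (1 + T ^ 2))) +
      (2 * p * γ + 2 * p * (p - 1)) * (v ^ 2 - κ ^ 2 * T ^ 2) := by ring
  rw [e]
  refine (abs_add_three _ _ _).trans ?_
  rw [abs_mul (2 * p), abs_mul (2 * p * γ + _)]
  have h6 : |2 * p| * |v - (κ * T + γ * κ ^ 2 * (1 + T ^ 2))| ≤ |2 * p| * (C * κ ^ 3) := by gcongr
  have h7 : |2 * p * γ + 2 * p * (p - 1)| * |v ^ 2 - κ ^ 2 * T ^ 2| ≤
    |2 * p * γ + 2 * p * (p - 1)| * (C * κ ^ 3) := by gcongr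
  linarith

/-! ### The horizontal chain and its drift -/

/-- The abscissa of the point where the ray leaving a boundary point above `x` at angle `a` meets
the opposite boundary curve of the tube extended to the left. -/
def landing (γ x a : ℝ) : ℝ := x * (1 + relJump γ (dirParam γ (x ^ (γ - 1)) (Real.tan a)))

/-- One step of the first coordinate of the collisions process. -/
def hstep (γ A x a : ℝ) : ℝ := if A < landing γ x a then landing γ x a else 2 * A

theorem measurable_tan : Measurable Real.tan := by
  have : Real.tan = fun x => Real.sin x / Real.cos x := funext Real.tan_eq_sin_div_cos
  rw [this]
  fun_prop

theorem measurable_landing (γ : ℝ) : Measurable fun z : ℝ × ℝ => landing γ z.1 z.2 := by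
  unfold landing dirParam
  have h1 := measurable_relJump γ
  have h2 := measurable_tan
  fun_prop

theorem measurable_hstep (γ A : ℝ) : Measurable fun z : ℝ × ℝ => hstep γ A z.1 z.2 :=
  Measurable.ite (measurableSet_lt measurable_const (measurable_landing γ))
    (measurable_landing γ) measurable_const

/-- The clipping of `relJump` makes this bound and the next one hold for every angle, without
smallness of `κ`. -/
theorem landing_pos {γ x : ℝ} (a : ℝ) (hx : 0 < x) : 0 < landing γ x a :=
  mul_pos hx (by linarith [(relJump_mem γ (dirParam γ (x ^ (γ - 1)) (Real.tan a))).1])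

theorem landing_le {γ x : ℝ} (a : ℝ) (hx : 0 < x) : landing γ x a ≤ 3 / 2 * x := by
  have := (relJump_mem γ (dirParam γ (x ^ (γ - 1)) (Real.tan a))).2
  unfold landing
  nlinarith

theorem lt_hstep {γ A x a : ℝ} (hA : 0 < A) : A < hstep γ A x a := by
  unfold hstep
  split_ifs with h
  · exact h
  · linarith

theorem landing_le_hstep {γ A x a : ℝ} (hA : 0 < A) : landing γ x a ≤ hstep γ A x a := by
  unfold hstep
  split_ifs with h
  · exact le_rfl
  · linarith

theorem hstep_le {γ A x a : ℝ} (hA : 0 < A) (hx : A < x) : hstep γ A x a ≤ 2 * x := by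
  unfold hstep
  split_ifs with h
  · linarith [landing_le (γ := γ) a (hA.trans hx)]
  · linarith

/-! ### Drift of powers under a symmetric angle law -/

section Symmetric

variable {μ : Measure ℝ} [IsProbabilityMeasure μ] {α₀ : ℝ}

theorem map_neg_eq_self (hsymm : ∀ x : ℝ, μ (Ici x) = μ (Iic (-x))) :
    μ.map (fun x => -x) = μ := by
  have : IsProbabilityMeasure (μ.map (fun x : ℝ => -x)) :=
    Measure.isProbabilityMeasure_map measurable_neg.aemeasurable
  refine Measure.ext_of_Ici _ _ fun x => ?_
  rw [Measure.map_apply measurable_neg measurableSet_Ici, hsymm]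
  congr 1
  ext y
  simp

theorem abs_tan_le (hα₀ : α₀ ∈ Ioo 0 (Real.pi / 2)) {a : ℝ} (ha : |a| < α₀) :
    |Real.tan a| ≤ Real.tan α₀ := by
  have h := abs_lt.1 ha
  have hm := Real.strictMonoOn_tan
  have h0 : α₀ ∈ Ioo (-(Real.pi / 2)) (Real.pi / 2) := ⟨by linarith [hα₀.1, Real.pi_pos], hα₀.2⟩
  have ha' : a ∈ Ioo (-(Real.pi / 2)) (Real.pi / 2) :=
    ⟨by linarith [hα₀.2], by linarith [hα₀.2]⟩
  have hn : -α₀ ∈ Ioo (-(Real.pi / 2)) (Real.pi / 2) :=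
    ⟨by linarith [hα₀.2], by linarith [hα₀.1, Real.pi_pos]⟩
  rw [abs_le, ← Real.tan_neg]
  exact ⟨(hm hn ha' h.1).le, (hm ha' h0 h.2).le⟩

theorem integrable_tan (hα₀ : α₀ ∈ Ioo 0 (Real.pi / 2)) (hbound : ∀ᵐ a ∂μ, |a| < α₀) :
    Integrable Real.tan μ :=
  Integrable.of_bound measurable_tan.aestronglyMeasurable (Real.tan α₀) <| by
    filter_upwards [hbound] with a ha using abs_tan_le hα₀ ha

theorem integrable_tan_sq (hα₀ : α₀ ∈ Ioo 0 (Real.pi / 2)) (hbound : ∀ᵐ a ∂μ, |a| < α₀) :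
    Integrable (fun a => Real.tan a ^ 2) μ :=
  Integrable.of_bound (measurable_tan.pow_const 2).aestronglyMeasurable (Real.tan α₀ ^ 2) <| by
    filter_upwards [hbound] with a ha
    rw [norm_pow]
    exact pow_le_pow_left₀ (norm_nonneg _) (abs_tan_le hα₀ ha) 2

/-- The tangent is odd. This cancels the term of order `κ`, so the drift starts at order `κ²`. -/
theorem integral_tan_eq_zero (hsymm : ∀ x : ℝ, μ (Ici x) = μ (Iic (-x))) :
    ∫ a, Real.tan a ∂μ = 0 := by
  have h : ∫ a, Real.tan a ∂μ = - ∫ a, Real.tan a ∂μ := by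
    conv_lhs => rw [← map_neg_eq_self hsymm]
    rw [integral_map measurable_neg.aemeasurable measurable_tan.aestronglyMeasurable]
    simp only [Real.tan_neg, integral_neg]
  linarith

/-- The coefficient of the drift of the `p`-th power of the horizontal chain. -/
def driftCoeff (γ : ℝ) (μ : Measure ℝ) (p : ℝ) : ℝ :=
  2 * p * γ * (1 + 2 * tanSqMean μ) + 2 * p * (p - 1) * tanSqMean μ

/-- The pointwise expansion is uniform over `|tan a| ≤ tan α₀`, so it may be integrated against `μ`
with the same error constant. -/
theorem integral_landing_rpow {γ : ℝ} (h₀ : 0 < γ) (h₁ : γ < 1)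
    (hα₀ : α₀ ∈ Ioo 0 (Real.pi / 2)) (hbound : ∀ᵐ a ∂μ, |a| < α₀)
    (hsymm : ∀ x : ℝ, μ (Ici x) = μ (Iic (-x))) (p : ℝ) :
    ∃ C κ₀ : ℝ, 0 < C ∧ 0 < κ₀ ∧ ∀ x : ℝ, 0 < x → x ^ (γ - 1) ≤ κ₀ →
      Integrable (fun a => landing γ x a ^ p) μ ∧
      |∫ a, landing γ x a ^ p ∂μ - x ^ p * (1 + (x ^ (γ - 1)) ^ 2 * driftCoeff γ μ p)| ≤
        x ^ p * (C * (x ^ (γ - 1)) ^ 3) := by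
  have hT₀ : 0 < Real.tan α₀ := Real.tan_pos_of_pos_of_lt_pi_div_two hα₀.1 hα₀.2
  obtain ⟨C, κ₀, hC, hκ₀, hexp⟩ := jump_rpow_expansion h₀ h₁ hT₀ p
  refine ⟨C, κ₀, hC, hκ₀, fun x hx hxκ => ?_⟩
  set κ := x ^ (γ - 1) with hκ
  have hκp : 0 < κ := Real.rpow_pos_of_pos hx _
  have i1 := integrable_tan (μ := μ) hα₀ hbound
  have i2 := integrable_tan_sq (μ := μ) hα₀ hbound
  let q : ℝ → ℝ := fun a => 1 + 2 * p * κ * Real.tan a +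
        κ ^ 2 * (2 * p * γ * (1 + 2 * Real.tan a ^ 2) + 2 * p * (p - 1) * Real.tan a ^ 2)
  let U : ℝ → ℝ := fun a => (1 + relJump γ (dirParam γ κ (Real.tan a))) ^ p
  have hq' : q = fun a => (1 + κ ^ 2 * (2 * p * γ)) + ((2 * p * κ) * Real.tan a +
      κ ^ 2 * (2 * p * γ * 2 + 2 * p * (p - 1)) * Real.tan a ^ 2) := by
    funext a; simp only [q]; ring
  have i12 : Integrable (fun a => 2 * p * κ * Real.tan a +
      κ ^ 2 * (2 * p * γ * 2 + 2 * p * (p - 1)) * Real.tan a ^ 2) μ :=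
    (i1.const_mul _).add (i2.const_mul _)
  have hqi : Integrable q μ := by
    rw [hq']
    exact (integrable_const _).add i12
  have hqI : ∫ a, q a ∂μ = 1 + κ ^ 2 * driftCoeff γ μ p := by
    rw [hq', integral_add (integrable_const _) i12,
      integral_add (i1.const_mul _) (i2.const_mul _), integral_const_mul, integral_const_mul,
      integral_tan_eq_zero hsymm]
    simp only [integral_const, probReal_univ, smul_eq_mul, driftCoeff, tanSqMean]
    ring
  have hUm : Measurable U := by
    have h1 := measurable_relJump γ
    have h2 := measurable_tan
    simp only [U, dirParam]
    fun_prop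
  have hae : ∀ᵐ a ∂μ, ‖U a - q a‖ ≤ C * κ ^ 3 := by
    filter_upwards [hbound] with a ha using hexp κ _ hκp hxκ (abs_tan_le hα₀ ha)
  have hdi : Integrable (fun a => U a - q a) μ :=
    Integrable.of_bound (hUm.aestronglyMeasurable.sub hqi.aestronglyMeasurable) _ hae
  have hUi : Integrable U μ := (hdi.add hqi).congr (by
    filter_upwards with a; simp)
  have hL : (fun a => landing γ x a ^ p) = fun a => x ^ p * U a := by
    funext a
    simp only [landing, U]
    rw [Real.mul_rpow hx.le]
    linarith [(relJump_mem γ (dirParam γ (x ^ (γ - 1)) (Real.tan a))).1]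
  rw [hL]
  refine ⟨hUi.const_mul _, ?_⟩
  rw [integral_const_mul, ← hqI, ← mul_sub, abs_mul, abs_of_pos (Real.rpow_pos_of_pos hx p),
    ← integral_sub hUi hqi]
  gcongr
  have := norm_integral_le_of_norm_le_const hae
  simpa using this

theorem exists_forall_rpow_le {γ : ℝ} (h₁ : γ < 1) {κ₀ : ℝ} (hκ₀ : 0 < κ₀) :
    ∃ A₀ : ℝ, 1 ≤ A₀ ∧ ∀ x : ℝ, A₀ ≤ x → x ^ (γ - 1) ≤ κ₀ := by
  have h := (tendsto_rpow_neg_atTop (by linarith : 0 < 1 - γ)).eventually_le_const hκ₀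
  obtain ⟨a, ha⟩ := eventually_atTop.1 h
  refine ⟨max 1 a, le_max_left _ _, fun x hx => ?_⟩
  have := ha x ((le_max_right _ _).trans hx)
  rwa [neg_sub] at this

theorem tanSqMean_nonneg (μ : Measure ℝ) : 0 ≤ tanSqMean μ :=
  integral_nonneg fun _ => sq_nonneg _

/-- Up to constants, the power `2 (1 - γ)` of the horizontal chain grows linearly. -/
theorem drift_linear {γ : ℝ} (h₀ : 0 < γ) (h₁ : γ < 1)
    (hα₀ : α₀ ∈ Ioo 0 (Real.pi / 2)) (hbound : ∀ᵐ a ∂μ, |a| < α₀)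
    (hsymm : ∀ x : ℝ, μ (Ici x) = μ (Iic (-x))) :
    ∃ A₀ c C : ℝ, 1 ≤ A₀ ∧ 0 < c ∧ 0 < C ∧ ∀ A x : ℝ, A₀ ≤ A → A < x →
      (ENNReal.ofReal (x ^ (2 * (1 - γ))) + ENNReal.ofReal c ≤
        ∫⁻ a, ENNReal.ofReal (hstep γ A x a ^ (2 * (1 - γ))) ∂μ) ∧
      ∫⁻ a, ENNReal.ofReal (hstep γ A x a ^ (2 * (1 - γ))) ∂μ ≤
        ENNReal.ofReal (x ^ (2 * (1 - γ))) + ENNReal.ofReal (C + (2 * A) ^ (2 * (1 - γ))) := by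
  set p := 2 * (1 - γ) with hp
  have hp0 : 0 < p := by linarith
  obtain ⟨C, κ₀, hC, hκ₀, hint⟩ := integral_landing_rpow h₀ h₁ hα₀ hbound hsymm p
  have hL : 0 < driftCoeff γ μ p := by
    have : driftCoeff γ μ p = 2 * p * (γ + tanSqMean μ) := by
      unfold driftCoeff; rw [hp]; ring
    rw [this]
    have := tanSqMean_nonneg μ
    positivity
  set L := driftCoeff γ μ p
  -- With `κ ≤ L / (2 C)` the error `C κ` is at most half of the drift `L`.
  obtain ⟨A₀, hA₀, hsmall⟩ := exists_forall_rpow_le h₁ (κ₀ := min κ₀ (L / (2 * C)))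
    (by positivity)
  refine ⟨A₀, L / 2, 2 * L, hA₀, by positivity, by positivity, fun A x hA hx => ?_⟩
  have hA0 : 0 < A := by linarith
  have hx0 : 0 < x := hA0.trans hx
  have hκ := hsmall x (hA.trans hx.le)
  obtain ⟨hi, hb⟩ := hint x hx0 (hκ.trans (min_le_left _ _))
  have hκC : x ^ (γ - 1) ≤ L / (2 * C) := hκ.trans (min_le_right _ _)
  rw [le_div_iff₀ (by positivity)] at hκC
  -- This identity dictates `p = 2 (1 - γ)`: the drift of `x ^ p` becomes independent of `x` to
  -- leading order.
  have hxp : x ^ p * (x ^ (γ - 1)) ^ 2 = 1 := by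
    rw [← Real.rpow_natCast, ← Real.rpow_mul hx0.le, ← Real.rpow_add hx0, hp]
    norm_num
    ring_nf
    simp
  have hlb : x ^ p + L / 2 ≤ ∫ a, landing γ x a ^ p ∂μ := by
    have e : x ^ p * (C * (x ^ (γ - 1)) ^ 3) = C * x ^ (γ - 1) := by
      linear_combination C * x ^ (γ - 1) * hxp
    have e2 : x ^ p * (1 + (x ^ (γ - 1)) ^ 2 * L) = x ^ p + L := by
      linear_combination L * hxp
    rw [e, e2] at hb
    linarith [(abs_le.1 hb).1]
  have hub : ∫ a, landing γ x a ^ p ∂μ ≤ x ^ p + 2 * L := by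
    have e : x ^ p * (C * (x ^ (γ - 1)) ^ 3) = C * x ^ (γ - 1) := by
      linear_combination C * x ^ (γ - 1) * hxp
    have e2 : x ^ p * (1 + (x ^ (γ - 1)) ^ 2 * L) = x ^ p + L := by
      linear_combination L * hxp
    rw [e, e2] at hb
    linarith [(abs_le.1 hb).2]
  have hx0p : 0 ≤ x ^ p := Real.rpow_nonneg hx0.le _
  have hlint := ofReal_integral_eq_lintegral_ofReal hi (ae_of_all _ fun a =>
    Real.rpow_nonneg (landing_pos a hx0).le _)
  constructor
  · rw [← ENNReal.ofReal_add hx0p (by positivity)]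
    refine (ENNReal.ofReal_le_ofReal hlb).trans (hlint.le.trans (lintegral_mono fun a => ?_))
    exact ENNReal.ofReal_le_ofReal
      (Real.rpow_le_rpow (landing_pos a hx0).le (landing_le_hstep hA0) hp0.le)
  · have h2A : 0 ≤ (2 * A) ^ p := Real.rpow_nonneg (by linarith) _
    calc ∫⁻ a, ENNReal.ofReal (hstep γ A x a ^ p) ∂μ
        ≤ ∫⁻ a, (ENNReal.ofReal (landing γ x a ^ p) + ENNReal.ofReal ((2 * A) ^ p)) ∂μ := by
          -- A restart at `2 A` costs at most `(2 A) ^ p`.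
          refine lintegral_mono fun a => ?_
          unfold hstep
          split_ifs
          · exact le_self_add
          · exact le_add_self
      _ = ENNReal.ofReal (∫ a, landing γ x a ^ p ∂μ) + ENNReal.ofReal ((2 * A) ^ p) := by
          rw [lintegral_add_right _ measurable_const, hlint]; simp
      _ ≤ ENNReal.ofReal (x ^ p + 2 * L) + ENNReal.ofReal ((2 * A) ^ p) := by gcongr
      _ = _ := by
          rw [ENNReal.ofReal_add hx0p (by positivity), ENNReal.ofReal_add (by positivity) h2A,
            add_assoc]

/-- Above the critical exponent a small negative power of the horizontal chain is a
supermartingale. -/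
theorem drift_supermartingale {γ : ℝ} (h₀ : 0 < γ) (h₁ : γ < 1)
    (hα₀ : α₀ ∈ Ioo 0 (Real.pi / 2)) (hbound : ∀ᵐ a ∂μ, |a| < α₀)
    (hsymm : ∀ x : ℝ, μ (Ici x) = μ (Iic (-x))) (hcrit : criticalExponent μ < γ) :
    ∃ A₀ δ : ℝ, 1 ≤ A₀ ∧ 0 < δ ∧ ∀ A x : ℝ, A₀ ≤ A → A < x →
      ∫⁻ a, ENNReal.ofReal (hstep γ A x a ^ (-δ)) ∂μ ≤ ENNReal.ofReal (x ^ (-δ)) := by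
  have hτ := tanSqMean_nonneg μ
  set τ := tanSqMean μ with hτ'
  -- This is the condition on the critical exponent with the denominator cleared; the gap leaves
  -- room for a small `δ`.
  have hgap : 0 < γ * (1 + 2 * τ) - τ := by
    unfold criticalExponent at hcrit
    rw [div_lt_iff₀ (by positivity)] at hcrit
    linarith
  obtain ⟨δ, hδ, hδτ⟩ : ∃ δ : ℝ, 0 < δ ∧ δ * τ < γ * (1 + 2 * τ) - τ := by
    refine ⟨(γ * (1 + 2 * τ) - τ) / (1 + τ), by positivity, ?_⟩
    rw [div_mul_eq_mul_div, div_lt_iff₀ (by positivity)]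
    nlinarith
  obtain ⟨C, κ₀, hC, hκ₀, hint⟩ := integral_landing_rpow h₀ h₁ hα₀ hbound hsymm (-δ)
  have hL : 0 < -driftCoeff γ μ (-δ) := by
    have : -driftCoeff γ μ (-δ) = 2 * δ * (γ * (1 + 2 * τ) - τ - δ * τ) := by
      unfold driftCoeff; rw [← hτ']; ring
    rw [this]
    have := sub_pos.2 hδτ
    positivity
  set L := driftCoeff γ μ (-δ)
  obtain ⟨A₀, hA₀, hsmall⟩ := exists_forall_rpow_le h₁ (κ₀ := min κ₀ (-L / C))
    (by positivity)
  refine ⟨A₀, δ, hA₀, hδ, fun A x hA hx => ?_⟩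
  have hA0 : 0 < A := by linarith
  have hx0 : 0 < x := hA0.trans hx
  have hκ := hsmall x (hA.trans hx.le)
  obtain ⟨hi, hb⟩ := hint x hx0 (hκ.trans (min_le_left _ _))
  have hκC : x ^ (γ - 1) ≤ -L / C := hκ.trans (min_le_right _ _)
  rw [le_div_iff₀ (by positivity)] at hκC
  have hub : ∫ a, landing γ x a ^ (-δ) ∂μ ≤ x ^ (-δ) := by
    have e : x ^ (-δ) * (1 + (x ^ (γ - 1)) ^ 2 * L) + x ^ (-δ) * (C * (x ^ (γ - 1)) ^ 3) =
      x ^ (-δ) + x ^ (-δ) * (x ^ (γ - 1)) ^ 2 * (L + x ^ (γ - 1) * C) := by ring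
    have h2 : 0 ≤ x ^ (-δ) * (x ^ (γ - 1)) ^ 2 :=
      mul_nonneg (Real.rpow_nonneg hx0.le _) (sq_nonneg _)
    have h3 : x ^ (-δ) * (x ^ (γ - 1)) ^ 2 * (L + x ^ (γ - 1) * C) ≤ 0 :=
      mul_nonpos_of_nonneg_of_nonpos h2 (by linarith)
    linarith [(abs_le.1 hb).2]
  have hlint := ofReal_integral_eq_lintegral_ofReal hi (ae_of_all _ fun a =>
    Real.rpow_nonneg (landing_pos a hx0).le _)
  calc ∫⁻ a, ENNReal.ofReal (hstep γ A x a ^ (-δ)) ∂μ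
      ≤ ∫⁻ a, ENNReal.ofReal (landing γ x a ^ (-δ)) ∂μ := by
        -- A restart at `2 A` only moves the chain to the right, which lowers a negative power.
        refine lintegral_mono fun a => ENNReal.ofReal_le_ofReal ?_
        exact Real.rpow_le_rpow_of_nonpos (landing_pos a hx0) (landing_le_hstep hA0) (by linarith)
    _ = _ := hlint.symm
    _ ≤ _ := ENNReal.ofReal_le_ofReal hub

end Symmetric

/-! ### Geometry of one step -/

section Frontier

variable {γ A : ℝ}

theorem isOpen_tube (h₀ : 0 < γ) : IsOpen (tube (fun x => x ^ γ) A) := by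
  have hc : Continuous fun p : ℝ × ℝ => p.1 ^ γ :=
    continuous_fst.rpow_const fun _ => Or.inr h₀.le
  exact (isOpen_lt continuous_const continuous_fst).inter
    (isOpen_lt (continuous_abs.comp continuous_snd) hc)

theorem notMem_frontier_of_mem_tube (h₀ : 0 < γ) {q : ℝ × ℝ}
    (hq : q ∈ tube (fun x => x ^ γ) A) : q ∉ frontier (tube (fun x => x ^ γ) A) := by
  rw [(isOpen_tube h₀).frontier_eq]
  exact fun h => h.2 hq

theorem abs_snd_eq_of_mem_frontier (h₀ : 0 < γ) {q : ℝ × ℝ}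
    (hq : q ∈ frontier (tube (fun x => x ^ γ) A)) (hA : A < q.1) : |q.2| = q.1 ^ γ := by
  rw [(isOpen_tube h₀).frontier_eq] at hq
  have hc : Continuous fun p : ℝ × ℝ => p.1 ^ γ :=
    continuous_fst.rpow_const fun _ => Or.inr h₀.le
  have hcl : IsClosed {p : ℝ × ℝ | |p.2| ≤ p.1 ^ γ} :=
    isClosed_le (continuous_abs.comp continuous_snd) hc
  have h1 : q ∈ {p : ℝ × ℝ | |p.2| ≤ p.1 ^ γ} :=
    closure_minimal (fun p hp => hp.2.le) hcl hq.1
  exact le_antisymm h1 (not_lt.1 fun h => hq.2 ⟨hA, h⟩)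

theorem mem_frontier_of_wall (h₀ : 0 < γ) (hA : 0 < A) {y : ℝ} (hy : |y| ≤ A ^ γ) :
    ((A, y) : ℝ × ℝ) ∈ frontier (tube (fun x => x ^ γ) A) := by
  rw [(isOpen_tube h₀).frontier_eq]
  refine ⟨?_, fun h => lt_irrefl _ h.1⟩
  have ht : Tendsto (fun x : ℝ => ((x, y) : ℝ × ℝ)) (𝓝[>] A) (𝓝 (A, y)) :=
    ((continuous_id.prodMk continuous_const).tendsto A).mono_left nhdsWithin_le_nhds
  refine mem_closure_of_tendsto ht ?_
  filter_upwards [self_mem_nhdsWithin] with x hx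
  exact ⟨hx, hy.trans_lt (Real.rpow_lt_rpow hA.le hx h₀)⟩

theorem mem_frontier_of_curve (h₀ : 0 < γ) (hA : 0 < A) {q : ℝ × ℝ} (hx : A < q.1)
    (hq : |q.2| = q.1 ^ γ) : q ∈ frontier (tube (fun x => x ^ γ) A) := by
  rw [(isOpen_tube h₀).frontier_eq]
  refine ⟨?_, fun h => absurd h.2 (by simp [hq])⟩
  have hpos : 0 < q.1 ^ γ := Real.rpow_pos_of_pos (hA.trans hx) _
  have ht : Tendsto (fun s : ℝ => ((q.1, s * q.2) : ℝ × ℝ)) (𝓝[<] 1) (𝓝 q) := by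
    have : Continuous fun s : ℝ => ((q.1, s * q.2) : ℝ × ℝ) := by fun_prop
    have h := (this.tendsto 1).mono_left (nhdsWithin_le_nhds (s := Iio 1))
    simpa using h
  refine mem_closure_of_tendsto ht ?_
  filter_upwards [Ioo_mem_nhdsLT (zero_lt_one (α := ℝ))] with s hs
  refine ⟨hx, ?_⟩
  simp only [abs_mul, hq, abs_of_pos hs.1]
  nlinarith [hs.2]

theorem step_of_isFirstHit {g : ℝ → ℝ} {A a : ℝ} {p q : ℝ × ℝ}
    (h : IsFirstHit (frontier (tube g A)) p (rayDirection g p a) q) :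
    step g A p a = if q.1 = A then some (2 * A, g (2 * A)) else some q := by
  have hex : ∃ q, IsFirstHit (frontier (tube g A)) p (rayDirection g p a) q := ⟨q, h⟩
  have hq : hex.choose = q := hex.choose_spec.unique h
  unfold step
  rw [dif_pos hex, hq]

/-- The height is `(1 - θ) x ^ γ - θ V ^ γ` up to sign. Its modulus is strictly below `(1 - θ) x ^ γ
+ θ V ^ γ`, which concavity bounds by the boundary height. -/
theorem segment_mem_tube (h₀ : 0 < γ) (h₁ : γ < 1) {x V θ σ : ℝ} (hσ : |σ| = 1)
    (hx : 0 < x) (hV : 0 < V) (hθ₀ : 0 < θ) (hθ₁ : θ < 1) (hA : A < x + θ * (V - x)) :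
    ((x + θ * (V - x), σ * (x ^ γ - θ * (x ^ γ + V ^ γ))) : ℝ × ℝ) ∈ tube (fun x => x ^ γ) A := by
  refine ⟨hA, ?_⟩
  have hcc := (Real.concaveOn_rpow h₀.le h₁.le).2 (mem_Ici.2 hx.le) (mem_Ici.2 hV.le)
    (by linarith : 0 ≤ 1 - θ) hθ₀.le (by ring)
  simp only [smul_eq_mul] at hcc
  have e : (1 - θ) * x + θ * V = x + θ * (V - x) := by ring
  rw [e] at hcc
  have px : 0 < x ^ γ := Real.rpow_pos_of_pos hx _
  have pV : 0 < V ^ γ := Real.rpow_pos_of_pos hV _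
  have h1 : 0 < (1 - θ) * x ^ γ := mul_pos (by linarith) px
  have h2 : 0 < θ * V ^ γ := mul_pos hθ₀ pV
  simp only [abs_mul, hσ, one_mul]
  refine lt_of_lt_of_le (abs_lt.2 ⟨?_, ?_⟩) hcc <;> linarith

/-- The version with endpoints included is needed when the chord ends exactly in the corner of the
tube, `V = A`. -/
theorem segment_closure_bound (h₀ : 0 < γ) (h₁ : γ < 1) {x V θ σ : ℝ} (hσ : |σ| = 1)
    (hx : 0 < x) (hV : 0 < V) (hθ₀ : 0 ≤ θ) (hθ₁ : θ ≤ 1) :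
    |σ * (x ^ γ - θ * (x ^ γ + V ^ γ))| ≤ (x + θ * (V - x)) ^ γ := by
  have hcc := (Real.concaveOn_rpow h₀.le h₁.le).2 (mem_Ici.2 hx.le) (mem_Ici.2 hV.le)
    (by linarith : 0 ≤ 1 - θ) hθ₀ (by ring)
  simp only [smul_eq_mul] at hcc
  have e : (1 - θ) * x + θ * V = x + θ * (V - x) := by ring
  rw [e] at hcc
  have px : 0 < x ^ γ := Real.rpow_pos_of_pos hx _
  have pV : 0 < V ^ γ := Real.rpow_pos_of_pos hV _
  have h1 : 0 ≤ (1 - θ) * x ^ γ := mul_nonneg (by linarith) px.le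
  have h2 : 0 ≤ θ * V ^ γ := mul_nonneg hθ₀ pV.le
  simp only [abs_mul, hσ, one_mul]
  refine le_trans (abs_le.2 ⟨?_, ?_⟩) hcc <;> linarith

end Frontier

/-- The sign `σ` marks the upper or lower curve. It is absent from the horizontal component, which
is why the first coordinate is an autonomous chain. -/
theorem rayDirection_eq {γ x σ a : ℝ} (hσ : σ = 1 ∨ σ = -1) (hx : 0 < x) (ha : 0 < Real.cos a) :
    ∃ c : ℝ, 0 < c ∧ rayDirection (fun x => x ^ γ) (x, σ * x ^ γ) a =
      (c * (γ * x ^ (γ - 1) + Real.tan a), -(c * σ * (1 - γ * x ^ (γ - 1) * Real.tan a))) := by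
  have px : 0 < x ^ γ := Real.rpow_pos_of_pos hx _
  have hd : deriv (fun x : ℝ => x ^ γ) x = γ * x ^ (γ - 1) :=
    (Real.hasDerivAt_rpow_const (Or.inl hx.ne')).deriv
  have hr : 0 < Real.sqrt (1 + (γ * x ^ (γ - 1)) ^ 2) := Real.sqrt_pos.2 (by positivity)
  refine ⟨Real.cos a * (Real.sqrt (1 + (γ * x ^ (γ - 1)) ^ 2))⁻¹, by positivity, ?_⟩
  have hs : Real.sin a = Real.cos a * Real.tan a := by
    rw [mul_comm, Real.tan_mul_cos ha.ne']
  unfold rayDirection innerNormal rightTangent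
  simp only [hd, hs]
  rcases hσ with rfl | rfl
  · simp only [one_mul, px, if_true]
    ext <;> simp <;> ring
  · have : ¬ (0 < -1 * x ^ γ) := by linarith
    simp only [this, if_false]
    ext <;> simp <;> ring

/-- In a thin tube, the first coordinate of the collisions process moves by `hstep`, and the
process never escapes to infinity. -/
theorem step_eq {γ : ℝ} (h₀ : 0 < γ) (h₁ : γ < 1) {α₀ : ℝ} (hα₀ : α₀ ∈ Ioo 0 (Real.pi / 2)) :
    ∃ A₀ : ℝ, 1 ≤ A₀ ∧ ∀ (A : ℝ) (p : ℝ × ℝ) (a : ℝ), A₀ ≤ A → A < p.1 → |p.2| = p.1 ^ γ →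
      |a| < α₀ → ∃ q : ℝ × ℝ, step (fun x => x ^ γ) A p a = some q ∧
        q.1 = hstep γ A p.1 a ∧ |q.2| = q.1 ^ γ := by
  have hT₀ : 0 < Real.tan α₀ := Real.tan_pos_of_pos_of_lt_pi_div_two hα₀.1 hα₀.2
  obtain ⟨C, κ₀, hC, hκ₀, hd⟩ := dirParam_expansion h₀ h₁ hT₀
  -- The bound `1 / (6 C)` gives `|v| ≤ 1/6`, the range in which `relJump` truly inverts
  -- `slopeRatio`.
  obtain ⟨A₀, hA₀, hsmall⟩ := exists_forall_rpow_le h₁ (κ₀ := min κ₀ (1 / (6 * C)))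
    (by positivity)
  refine ⟨A₀, hA₀, fun A p a hA hp hp2 ha => ?_⟩
  obtain ⟨x, y⟩ := p
  simp only at hp hp2
  have hA0 : 0 < A := by linarith
  have hx : 0 < x := hA0.trans hp
  have px : 0 < x ^ γ := Real.rpow_pos_of_pos hx _
  obtain ⟨σ, hσ, rfl⟩ : ∃ σ : ℝ, (σ = 1 ∨ σ = -1) ∧ y = σ * x ^ γ := by
    rcases abs_choice y with h | h
    · exact ⟨1, Or.inl rfl, by rw [one_mul, ← hp2, h]⟩
    · exact ⟨-1, Or.inr rfl, by rw [← hp2, h]; ring⟩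
  have hσ' : |σ| = 1 := by rcases hσ with rfl | rfl <;> simp
  have hκ := hsmall x (hA.trans hp.le)
  have hcos : 0 < Real.cos a := by
    have := abs_lt.1 ha
    exact Real.cos_pos_of_mem_Ioo ⟨by linarith [hα₀.2], by linarith [hα₀.2]⟩
  obtain ⟨c, hc, hdir⟩ := rayDirection_eq (γ := γ) hσ hx hcos
  obtain ⟨hden, hv, -⟩ := hd (x ^ (γ - 1)) (Real.tan a) (Real.rpow_pos_of_pos hx _)
    (hκ.trans (min_le_left _ _)) (abs_tan_le hα₀ ha)
  have hκC := hκ.trans (min_le_right _ _)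
  rw [le_div_iff₀ (by positivity)] at hκC
  have hv6 : |dirParam γ (x ^ (γ - 1)) (Real.tan a)| ≤ 1 / 6 := by linarith
  have hu := relJump_eq h₀ h₁ hv6
  have hum := relJump_mem γ (dirParam γ (x ^ (γ - 1)) (Real.tan a))
  have hVdef : landing γ x a = x * (1 + relJump γ (dirParam γ (x ^ (γ - 1)) (Real.tan a))) := rfl
  have hVpos := landing_pos (γ := γ) a hx
  have hVγ : landing γ x a ^ γ =
      x ^ γ * (1 + relJump γ (dirParam γ (x ^ (γ - 1)) (Real.tan a))) ^ γ := by
    rw [hVdef, Real.mul_rpow hx.le (by linarith [hum.1])]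
  have hxκ : x ^ γ = x ^ (γ - 1) * x := by
    rw [Real.rpow_sub_one hx.ne', div_mul_cancel₀ _ hx.ne']
  set V := landing γ x a
  have pV : 0 < V ^ γ := Real.rpow_pos_of_pos hVpos _
  set D := 1 - γ * x ^ (γ - 1) * Real.tan a with hD
  have hD0 : 0 < D := by linarith
  -- `S` is the ray parameter at which the vertical displacement is `x ^ γ + V ^ γ`. That the
  -- horizontal one is then `V - x` is the fixed-point equation for `relJump`.
  set S := (x ^ γ + V ^ γ) / (c * D) with hS
  have hS0 : 0 < S := by positivity
  have hSx : S * (c * (γ * x ^ (γ - 1) + Real.tan a)) = V - x := by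
    have e1 : V - x = x * (dirParam γ (x ^ (γ - 1)) (Real.tan a) *
        (1 + (1 + relJump γ (dirParam γ (x ^ (γ - 1)) (Real.tan a))) ^ γ)) := by
      rw [← hu, hVdef]; ring
    rw [e1, hS, hVγ, hxκ]
    simp only [dirParam]
    rw [← hD]
    field_simp
    ring
  have hSy : S * (c * D) = x ^ γ + V ^ γ := div_mul_cancel₀ _ (by positivity)
  have hpt : ∀ θ : ℝ, ((x, σ * x ^ γ) : ℝ × ℝ) + (θ * S) •
      rayDirection (fun x => x ^ γ) (x, σ * x ^ γ) a =
      (x + θ * (V - x), σ * (x ^ γ - θ * (x ^ γ + V ^ γ))) := by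
    intro θ
    rw [hdir]
    ext
    · simp only [Prod.fst_add, Prod.smul_fst, smul_eq_mul]
      linear_combination θ * hSx
    · simp only [Prod.snd_add, Prod.smul_snd, smul_eq_mul]
      linear_combination -(σ * θ) * hSy
  have hptt : ∀ s : ℝ, ((x, σ * x ^ γ) : ℝ × ℝ) + s •
      rayDirection (fun x => x ^ γ) (x, σ * x ^ γ) a =
      (x + s / S * (V - x), σ * (x ^ γ - s / S * (x ^ γ + V ^ γ))) := by
    intro s
    rw [← hpt, div_mul_cancel₀ _ hS0.ne']
  -- If `V > A` the ray first hits the opposite curve. Otherwise it first meets the wall, at the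
  -- fraction `θ₁` of the chord.
  rcases lt_or_ge A V with hAV | hAV
  · have hhit : IsFirstHit (frontier (tube (fun x => x ^ γ) A)) (x, σ * x ^ γ)
        (rayDirection (fun x => x ^ γ) (x, σ * x ^ γ) a) (V, -σ * V ^ γ) := by
      have habs : |(-σ) * V ^ γ| = V ^ γ := by
        rw [abs_mul, abs_neg, hσ', one_mul, abs_of_pos pV]
      refine ⟨S, hS0, ?_, mem_frontier_of_curve h₀ hA0 hAV habs, fun s hs hsS => ?_⟩
      · rw [hptt, div_self hS0.ne']
        ext
        · simp
        · simp
      · rw [hptt]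
        have hθ : s / S < 1 := (div_lt_one hS0).2 hsS
        have hθ0 : 0 < s / S := by positivity
        refine notMem_frontier_of_mem_tube h₀
          (segment_mem_tube h₀ h₁ hσ' hx hVpos hθ0 hθ ?_)
        nlinarith
    refine ⟨(V, -σ * V ^ γ), ?_, ?_, ?_⟩
    · rw [step_of_isFirstHit hhit, if_neg hAV.ne']
    · simp only [hstep]
      rw [if_pos hAV]
    · simp only
      rw [abs_mul, abs_neg, hσ', one_mul, abs_of_pos pV]
  · have hVx : 0 < x - V := by linarith
    set θ₁ := (x - A) / (x - V) with hθ₁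
    have hθ0 : 0 < θ₁ := div_pos (by linarith) hVx
    have hθ1 : θ₁ ≤ 1 := (div_le_one hVx).2 (by linarith)
    have hθx : θ₁ * (x - V) = x - A := div_mul_cancel₀ _ hVx.ne'
    have hxA : x + θ₁ * (V - x) = A := by linarith
    have hhit : IsFirstHit (frontier (tube (fun x => x ^ γ) A)) (x, σ * x ^ γ)
        (rayDirection (fun x => x ^ γ) (x, σ * x ^ γ) a)
        (A, σ * (x ^ γ - θ₁ * (x ^ γ + V ^ γ))) := by
      refine ⟨θ₁ * S, by positivity, ?_, ?_, fun s hs hsS => ?_⟩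
      · rw [hpt, hxA]
      · refine mem_frontier_of_wall h₀ hA0 ?_
        have := segment_closure_bound h₀ h₁ hσ' hx hVpos hθ0.le hθ1
        rwa [hxA] at this
      · rw [hptt]
        have hθ : s / S < θ₁ := (div_lt_iff₀ hS0).2 hsS
        have hθ0 : 0 < s / S := by positivity
        refine notMem_frontier_of_mem_tube h₀
          (segment_mem_tube h₀ h₁ hσ' hx hVpos hθ0 (hθ.trans_le hθ1) ?_)
        nlinarith
    refine ⟨(2 * A, (2 * A) ^ γ), ?_, ?_, ?_⟩
    · rw [step_of_isFirstHit hhit, if_pos rfl]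
    · simp only [hstep]
      rw [if_neg (not_lt.2 hAV)]
    · exact abs_of_pos (Real.rpow_pos_of_pos (by linarith) _)

/-! ### Markov chains driven by an i.i.d. sequence -/

/-- The sequence `s₀, Φ s₀ (b 0), Φ (Φ s₀ (b 0)) (b 1), …`. -/
def driven {S : Type*} (Φ : S → ℝ → S) (s₀ : S) (b : ℕ → ℝ) : ℕ → S
  | 0 => s₀
  | n + 1 => Φ (driven Φ s₀ b n) (b n)

/-- The dynamics `Φ` stopped on entering `K`. -/
def stopOn {S : Type*} (K : Set S) [DecidablePred (· ∈ K)] (Φ : S → ℝ → S) (s : S) (a : ℝ) : S :=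
  if s ∈ K then s else Φ s a

section Driven

variable {S : Type*} {Φ : S → ℝ → S} {s₀ : S}

theorem driven_congr {b b' : ℕ → ℝ} {n : ℕ} (h : ∀ k < n, b k = b' k) :
    driven Φ s₀ b n = driven Φ s₀ b' n := by
  induction n with
  | zero => rfl
  | succ n ih =>
    simp only [driven]
    rw [ih fun k hk => h k (by omega), h n (by omega)]

theorem driven_mem {G : Set S} (h₀ : s₀ ∈ G) (hG : ∀ s ∈ G, ∀ a, Φ s a ∈ G) (b : ℕ → ℝ) (n : ℕ) :
    driven Φ s₀ b n ∈ G := by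
  induction n with
  | zero => exact h₀
  | succ n ih => exact hG _ ih _

theorem stopOn_mem {G K : Set S} [DecidablePred (· ∈ K)] (hG : ∀ s ∈ G, ∀ a, Φ s a ∈ G) :
    ∀ s ∈ G, ∀ a, stopOn K Φ s a ∈ G := by
  intro s hs a
  unfold stopOn
  split_ifs
  exacts [hs, hG s hs a]

/-- A stopped chain outside `K` at time `n` has never been frozen. Events about the whole past thus
become events about the stopped chain at time `n`. -/
theorem driven_stopOn_eq {K : Set S} [DecidablePred (· ∈ K)] {b : ℕ → ℝ} {n : ℕ}
    (h : driven (stopOn K Φ) s₀ b n ∉ K) :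
    driven (stopOn K Φ) s₀ b n = driven Φ s₀ b n ∧ ∀ m ≤ n, driven Φ s₀ b m ∉ K := by
  induction n with
  | zero => exact ⟨rfl, fun m hm => by rw [Nat.le_zero.1 hm]; exact h⟩
  | succ n ih =>
    have hn : driven (stopOn K Φ) s₀ b n ∉ K := fun hn => h (by
      rw [driven, stopOn, if_pos hn]; exact hn)
    obtain ⟨e, hm⟩ := ih hn
    have e' : driven (stopOn K Φ) s₀ b (n + 1) = driven Φ s₀ b (n + 1) := by
      rw [driven, stopOn, if_neg hn, e, driven]
    refine ⟨e', fun m hmn => ?_⟩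
    rcases Nat.le_succ_iff.1 hmn with hle | rfl
    · exact hm m hle
    · rw [← e']; exact h

theorem driven_stopOn_mem_iff {K : Set S} [DecidablePred (· ∈ K)] {b : ℕ → ℝ} {n : ℕ} :
    driven (stopOn K Φ) s₀ b n ∈ K ↔ ∃ m ≤ n, driven Φ s₀ b m ∈ K := by
  refine ⟨fun h => ?_, fun ⟨m, hm, hK⟩ => by_contra fun h => (driven_stopOn_eq h).2 m hm hK⟩
  induction n with
  | zero => exact ⟨0, le_rfl, h⟩
  | succ n ih =>
    by_cases hn : driven (stopOn K Φ) s₀ b n ∈ K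
    · obtain ⟨m, hm, hK⟩ := ih hn
      exact ⟨m, by omega, hK⟩
    · refine ⟨n + 1, le_rfl, ?_⟩
      rw [driven, stopOn, if_neg hn, (driven_stopOn_eq hn).1] at h
      exact h

variable [MeasurableSpace S]

theorem measurable_driven (hΦ : Measurable (Function.uncurry Φ)) (n : ℕ) :
    Measurable fun b : ℕ → ℝ => driven Φ s₀ b n := by
  induction n with
  | zero => exact measurable_const
  | succ n ih => exact hΦ.comp (ih.prodMk (measurable_pi_apply n))

theorem measurable_stopOn {K : Set S} [DecidablePred (· ∈ K)] (hK : MeasurableSet K)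
    (hΦ : Measurable (Function.uncurry Φ)) : Measurable (Function.uncurry (stopOn K Φ)) :=
  Measurable.ite (measurable_fst hK) measurable_fst hΦ

variable {Ω : Type*} [MeasurableSpace Ω] {P : Measure Ω}
  {μ : Measure ℝ} {α : ℕ → Ω → ℝ}

theorem measurable_driven_comp (hm : ∀ k, Measurable (α k))
    (hΦ : Measurable (Function.uncurry Φ)) (n : ℕ) :
    Measurable fun ω => driven Φ s₀ (fun k => α k ω) n :=
  (measurable_driven hΦ n).comp (measurable_pi_lambda _ hm)

/-- The state at time `n` uses only the first `n` angles; padding by zeros in `ext` is harmless by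
`driven_congr`. -/
theorem indepFun_driven (hm : ∀ k, Measurable (α k)) (hind : iIndepFun α P)
    (hΦ : Measurable (Function.uncurry Φ)) (n : ℕ) :
    IndepFun (fun ω => driven Φ s₀ (fun k => α k ω) n) (α n) P := by
  have h := hind.indepFun_finset (Finset.range n) {n} (by simp) hm
  let ext : ((i : Finset.range n) → ℝ) → ℕ → ℝ :=
    fun w k => if h : k ∈ Finset.range n then w ⟨k, h⟩ else 0
  have hext : Measurable ext := by
    refine measurable_pi_lambda _ fun k => ?_
    by_cases hk : k ∈ Finset.range n
    · simp only [ext, hk, dif_pos]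
      exact measurable_pi_apply _
    · simp only [ext, hk, dif_neg, not_false_iff]
      exact measurable_const
  have h2 := h.comp ((measurable_driven (s₀ := s₀) hΦ n).comp hext)
    (measurable_pi_apply (⟨n, by simp⟩ : ({n} : Finset ℕ)))
  convert! h2 using 1
  funext ω
  exact driven_congr fun k hk => by simp [ext, hk]

variable [IsProbabilityMeasure P]

/-- The Markov property in integrated form: independence makes the joint law of state and angle a
product, and Tonelli applies. -/
theorem lintegral_driven_succ (hm : ∀ k, Measurable (α k)) (hind : iIndepFun α P)
    (hlaw : ∀ k, P.map (α k) = μ) (hΦ : Measurable (Function.uncurry Φ))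
    {V : S → ENNReal} (hV : Measurable V) (n : ℕ) :
    ∫⁻ ω, V (driven Φ s₀ (fun k => α k ω) (n + 1)) ∂P =
      ∫⁻ ω, ∫⁻ a, V (Φ (driven Φ s₀ (fun k => α k ω) n) a) ∂μ ∂P := by
  have hX := measurable_driven_comp (s₀ := s₀) hm hΦ n
  have hprod := (indepFun_iff_map_prod_eq_prod_map_map hX.aemeasurable
    (hm n).aemeasurable).1 (indepFun_driven hm hind hΦ n)
  have hμ : IsProbabilityMeasure μ := by
    rw [← hlaw n]; exact Measure.isProbabilityMeasure_map (hm n).aemeasurable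
  have hVΦ : Measurable fun z : S × ℝ => V (Φ z.1 z.2) := hV.comp hΦ
  calc ∫⁻ ω, V (driven Φ s₀ (fun k => α k ω) (n + 1)) ∂P
      = ∫⁻ z, V (Φ z.1 z.2) ∂(P.map fun ω => (driven Φ s₀ (fun k => α k ω) n, α n ω)) := by
        rw [lintegral_map hVΦ (hX.prodMk (hm n))]
        rfl
    _ = _ := by
        rw [hprod, hlaw, lintegral_prod _ hVΦ.aemeasurable,
          lintegral_map hVΦ.lintegral_prod_right' hX]

theorem lintegral_driven_le (hm : ∀ k, Measurable (α k)) (hind : iIndepFun α P)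
    (hlaw : ∀ k, P.map (α k) = μ) (hΦ : Measurable (Function.uncurry Φ))
    {V : S → ENNReal} (hV : Measurable V) {G : Set S} (h₀ : s₀ ∈ G)
    (hG : ∀ s ∈ G, ∀ a, Φ s a ∈ G) {c : ENNReal}
    (hdrift : ∀ s ∈ G, ∫⁻ a, V (Φ s a) ∂μ ≤ V s + c) (n : ℕ) :
    ∫⁻ ω, V (driven Φ s₀ (fun k => α k ω) n) ∂P ≤ V s₀ + n * c := by
  induction n with
  | zero => simp [driven]
  | succ n ih =>
    rw [lintegral_driven_succ hm hind hlaw hΦ hV]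
    calc _ ≤ ∫⁻ ω, (V (driven Φ s₀ (fun k => α k ω) n) + c) ∂P :=
          lintegral_mono fun ω => hdrift _ (driven_mem h₀ hG _ n)
      _ = ∫⁻ ω, V (driven Φ s₀ (fun k => α k ω) n) ∂P + c := by
          rw [lintegral_add_right _ measurable_const]; simp
      _ ≤ V s₀ + n * c + c := by gcongr
      _ = _ := by push_cast; ring

theorem sum_lintegral_driven_le (hm : ∀ k, Measurable (α k)) (hind : iIndepFun α P)
    (hlaw : ∀ k, P.map (α k) = μ) (hΦ : Measurable (Function.uncurry Φ))
    {V d : S → ENNReal} (hV : Measurable V) (hd : Measurable d) {G : Set S} (h₀ : s₀ ∈ G)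
    (hG : ∀ s ∈ G, ∀ a, Φ s a ∈ G)
    (hdrift : ∀ s ∈ G, V s + d s ≤ ∫⁻ a, V (Φ s a) ∂μ) (n : ℕ) :
    ∑ k ∈ Finset.range n, ∫⁻ ω, d (driven Φ s₀ (fun k => α k ω) k) ∂P ≤
      ∫⁻ ω, V (driven Φ s₀ (fun k => α k ω) n) ∂P := by
  induction n with
  | zero => simp
  | succ n ih =>
    rw [lintegral_driven_succ hm hind hlaw hΦ hV, Finset.sum_range_succ]
    calc _ ≤ ∫⁻ ω, V (driven Φ s₀ (fun k => α k ω) n) ∂P +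
          ∫⁻ ω, d (driven Φ s₀ (fun k => α k ω) n) ∂P := by gcongr
      _ = ∫⁻ ω, (V (driven Φ s₀ (fun k => α k ω) n) + d (driven Φ s₀ (fun k => α k ω) n)) ∂P :=
          (lintegral_add_right _ (hd.comp (measurable_driven_comp hm hΦ n))).symm
      _ ≤ _ := lintegral_mono fun ω => hdrift _ (driven_mem h₀ hG _ n)

end Driven

/-! ### Maximal inequalities for the horizontal chain -/

section Maximal

open scoped Classical

variable {Ω : Type*} [MeasurableSpace Ω] {P : Measure Ω} [IsProbabilityMeasure P]
  {μ : Measure ℝ} {α : ℕ → Ω → ℝ} {F : ℝ → ℝ → ℝ} {A x₀ p : ℝ}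

/-- Doob-type maximal inequality: freeze the chain once its power reaches `y`, then apply Markov's
inequality at time `n`. -/
theorem measure_exists_le_rpow (hm : ∀ k, Measurable (α k)) (hind : iIndepFun α P)
    (hlaw : ∀ k, P.map (α k) = μ) (hF : Measurable (Function.uncurry F))
    (hA : 0 < A) (hx₀ : A < x₀) (hFA : ∀ x, A < x → ∀ a, A < F x a) {C : ℝ} (hC : 0 ≤ C)
    (hdrift : ∀ x, A < x →
      ∫⁻ a, ENNReal.ofReal (F x a ^ p) ∂μ ≤ ENNReal.ofReal (x ^ p) + ENNReal.ofReal C)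
    [IsProbabilityMeasure μ] {y : ℝ} (hy : 0 < y) (n : ℕ) :
    P {ω | ∃ m ≤ n, y ≤ driven F x₀ (fun k => α k ω) m ^ p} ≤
      ENNReal.ofReal ((x₀ ^ p + n * C) / y) := by
  let K : Set ℝ := {x | y ≤ x ^ p}
  have hK : MeasurableSet K := measurableSet_le measurable_const (by fun_prop)
  have hΦ := measurable_stopOn hK hF
  have hV : Measurable fun x : ℝ => ENNReal.ofReal (x ^ p) := by fun_prop
  have hE := lintegral_driven_le (s₀ := x₀) (G := Ioi A) (c := ENNReal.ofReal C) hm hind hlaw hΦ hV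
    hx₀ (stopOn_mem hFA) (fun x hx => by
      by_cases hxK : x ∈ K
      · simp [stopOn, hxK]
      · simpa [stopOn, hxK] using hdrift x hx) n
  have hx₀p : 0 ≤ x₀ ^ p := Real.rpow_nonneg (hA.trans hx₀).le _
  have hset : {ω | ∃ m ≤ n, y ≤ driven F x₀ (fun k => α k ω) m ^ p} ⊆
      {ω | ENNReal.ofReal y ≤
        ENNReal.ofReal (driven (stopOn K F) x₀ (fun k => α k ω) n ^ p)} := by
    intro ω hω
    have h : driven (stopOn K F) x₀ (fun k => α k ω) n ∈ K := driven_stopOn_mem_iff.2 hω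
    exact ENNReal.ofReal_le_ofReal h
  rw [ENNReal.ofReal_div_of_pos hy, ENNReal.le_div_iff_mul_le (Or.inl (by simpa using hy))
    (Or.inl (by simp)), mul_comm]
  calc _ ≤ ENNReal.ofReal y * P {ω | ENNReal.ofReal y ≤
        ENNReal.ofReal (driven (stopOn K F) x₀ (fun k => α k ω) n ^ p)} := by gcongr
    _ ≤ ∫⁻ ω, ENNReal.ofReal (driven (stopOn K F) x₀ (fun k => α k ω) n ^ p) ∂P :=
        mul_meas_ge_le_lintegral (hV.comp (measurable_driven_comp hm hΦ n)) _
    _ ≤ _ := hE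
    _ = _ := by
        rw [ENNReal.ofReal_add hx₀p (by positivity), ENNReal.ofReal_mul (by positivity)]
        simp

/-- Each step taken below level `y` adds at least `c` in mean, while the stopped chain cannot
overshoot beyond `2 ^ p y` (or its start). Hence `n c P(E)` is at most the total possible gain. -/
theorem measure_forall_rpow_lt (hm : ∀ k, Measurable (α k)) (hind : iIndepFun α P)
    (hlaw : ∀ k, P.map (α k) = μ) (hF : Measurable (Function.uncurry F)) (hp : 0 < p)
    (hA : 0 < A) (hx₀ : A < x₀) (hFA : ∀ x, A < x → ∀ a, A < F x a)
    (hF2 : ∀ x, A < x → ∀ a, F x a ≤ 2 * x) {c : ℝ} (hc : 0 < c)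
    (hdrift : ∀ x, A < x →
      ENNReal.ofReal (x ^ p) + ENNReal.ofReal c ≤ ∫⁻ a, ENNReal.ofReal (F x a ^ p) ∂μ)
    [IsProbabilityMeasure μ] {y : ℝ} (hy : 0 < y) {n : ℕ} (hn : 0 < n) :
    P {ω | ∀ m ≤ n, driven F x₀ (fun k => α k ω) m ^ p < y} ≤
      ENNReal.ofReal ((x₀ ^ p + 2 ^ p * y) / (n * c)) := by
  let K : Set ℝ := {x | y ≤ x ^ p}
  have hK : MeasurableSet K := measurableSet_le measurable_const (by fun_prop)
  have hΦ := measurable_stopOn hK hF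
  have hV : Measurable fun x : ℝ => ENNReal.ofReal (x ^ p) := by fun_prop
  have hd : Measurable (Kᶜ.indicator fun _ : ℝ => ENNReal.ofReal c) :=
    measurable_const.indicator hK.compl
  have hE := sum_lintegral_driven_le (s₀ := x₀) (G := Ioi A) hm hind hlaw hΦ hV hd
    hx₀ (stopOn_mem hFA) (fun x hx => by
      by_cases hxK : x ∈ K
      · simp [stopOn, hxK]
      · simpa [stopOn, hxK] using hdrift x hx) n
  have hx₀p : 0 ≤ x₀ ^ p := Real.rpow_nonneg (hA.trans hx₀).le _
  have h2p : 0 < (2 : ℝ) ^ p := Real.rpow_pos_of_pos (by norm_num) _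
  have hub : ∀ ω, driven (stopOn K F) x₀ (fun k => α k ω) n ^ p ≤ x₀ ^ p + 2 ^ p * y := by
    intro ω
    have : driven (stopOn K F) x₀ (fun k => α k ω) n ∈
        {x | A < x ∧ x ^ p ≤ x₀ ^ p + 2 ^ p * y} := by
      refine driven_mem (G := {x | A < x ∧ x ^ p ≤ x₀ ^ p + 2 ^ p * y}) ⟨hx₀, le_add_of_nonneg_right (by positivity)⟩ ?_ _ n
      rintro x ⟨hx, hxy⟩ a
      unfold stopOn
      split_ifs with hxK
      · exact ⟨hx, hxy⟩
      · refine ⟨hFA x hx a, ?_⟩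
        have hx0 : 0 < x := hA.trans hx
        calc F x a ^ p ≤ (2 * x) ^ p :=
              Real.rpow_le_rpow (hA.trans (hFA x hx a)).le (hF2 x hx a) hp.le
          _ = 2 ^ p * x ^ p := Real.mul_rpow (by norm_num) hx0.le
          _ ≤ 2 ^ p * y := by
              have : x ^ p ≤ y := (not_le.1 hxK).le
              gcongr
          _ ≤ _ := le_add_of_nonneg_left hx₀p
    exact this.2
  set E := {ω | ∀ m ≤ n, driven F x₀ (fun k => α k ω) m ^ p < y}
  have hlow : ∀ k < n, ENNReal.ofReal c * P E ≤ ∫⁻ ω, Kᶜ.indicator (fun _ => ENNReal.ofReal c)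
      (driven (stopOn K F) x₀ (fun k => α k ω) k) ∂P := by
    intro k hk
    have hms := (measurable_driven_comp (s₀ := x₀) hm hΦ k) hK.compl
    calc ENNReal.ofReal c * P E ≤ ENNReal.ofReal c *
          P ((fun ω => driven (stopOn K F) x₀ (fun k => α k ω) k) ⁻¹' Kᶜ) := by
          gcongr
          intro ω hω hmem
          obtain ⟨m, hmk, hmK⟩ := driven_stopOn_mem_iff.1 hmem
          exact not_lt.2 hmK (hω m (by omega))
      _ = ∫⁻ ω, ((fun ω => driven (stopOn K F) x₀ (fun k => α k ω) k) ⁻¹' Kᶜ).indicator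
            (fun _ => ENNReal.ofReal c) ω ∂P := by
          rw [lintegral_indicator hms, setLIntegral_const]
      _ = _ := rfl
  have hsum : n * (ENNReal.ofReal c * P E) ≤ ENNReal.ofReal (x₀ ^ p + 2 ^ p * y) := by
    calc n * (ENNReal.ofReal c * P E) = ∑ k ∈ Finset.range n, ENNReal.ofReal c * P E := by simp
      _ ≤ _ := Finset.sum_le_sum fun k hk => hlow k (Finset.mem_range.1 hk)
      _ ≤ _ := hE
      _ ≤ ∫⁻ _, ENNReal.ofReal (x₀ ^ p + 2 ^ p * y) ∂P :=
          lintegral_mono fun ω => ENNReal.ofReal_le_ofReal (hub ω)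
      _ = _ := by simp
  have hnc : 0 < n * c := by positivity
  rw [ENNReal.ofReal_div_of_pos hnc, ENNReal.le_div_iff_mul_le (Or.inl (ENNReal.ofReal_pos.2 hnc).ne')
    (Or.inl ENNReal.ofReal_ne_top), ENNReal.ofReal_mul (by positivity)]
  refine le_trans (le_of_eq ?_) hsum
  simp
  ring

theorem runningMax_zero (u : ℕ → ℝ) : runningMax u 0 = u 0 := by
  simp [runningMax]

theorem runningMax_succ (u : ℕ → ℝ) (n : ℕ) :
    runningMax u (n + 1) = max (runningMax u n) (u (n + 1)) := by
  unfold runningMax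
  refine le_antisymm (Finset.sup'_le _ _ fun k hk => ?_) (max_le ?_ ?_)
  · rcases Nat.lt_succ_iff_lt_or_eq.1 (Finset.mem_range.1 hk) with h | rfl
    · exact le_max_of_le_left (Finset.le_sup' u (Finset.mem_range.2 h))
    · exact le_max_right _ _
  · exact Finset.sup'_mono _ (Finset.range_mono (by omega)) _
  · exact Finset.le_sup' u (Finset.self_mem_range_succ _)

theorem le_runningMax (u : ℕ → ℝ) {m n : ℕ} (h : m ≤ n) : u m ≤ runningMax u n :=
  Finset.le_sup' u (Finset.mem_range.2 (by omega))

theorem exists_eq_runningMax (u : ℕ → ℝ) (n : ℕ) : ∃ m ≤ n, runningMax u n = u m := by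
  obtain ⟨m, hm, h⟩ := Finset.exists_mem_eq_sup' (Finset.nonempty_range_add_one (n := n)) u
  exact ⟨m, by simpa [Nat.lt_succ_iff] using hm, h⟩

/-- The chain together with its running maximum. -/
def withMax (F : ℝ → ℝ → ℝ) (z : ℝ × ℝ) (a : ℝ) : ℝ × ℝ := (F z.1 a, max z.2 (F z.1 a))

theorem driven_withMax (F : ℝ → ℝ → ℝ) (x₀ : ℝ) (b : ℕ → ℝ) (n : ℕ) :
    driven (withMax F) (x₀, x₀) b n = (driven F x₀ b n, runningMax (driven F x₀ b) n) := by
  induction n with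
  | zero => simp [driven, runningMax_zero]
  | succ n ih => rw [driven, ih, runningMax_succ]; rfl

/-- Supermartingale argument on the pair of position and running maximum: the event of a drop forces
the stopped potential `V` to reach `z ^ (-δ)`, while it starts at most at `y ^ (-δ)`. -/
theorem measure_exists_drop (hm : ∀ k, Measurable (α k)) (hind : iIndepFun α P)
    (hlaw : ∀ k, P.map (α k) = μ) (hF : Measurable (Function.uncurry F))
    (hA : 0 < A) (hx₀ : A < x₀) (hFA : ∀ x, A < x → ∀ a, A < F x a) {δ : ℝ} (hδ : 0 < δ)
    (hdrift : ∀ x, A < x →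
      ∫⁻ a, ENNReal.ofReal (F x a ^ (-δ)) ∂μ ≤ ENNReal.ofReal (x ^ (-δ)))
    [IsProbabilityMeasure μ] {y z : ℝ} (hy : 0 < y) (hz : 0 < z) :
    P {ω | ∃ m, y ≤ runningMax (driven F x₀ (fun k => α k ω)) m ∧
      driven F x₀ (fun k => α k ω) m < z} ≤ ENNReal.ofReal ((z / y) ^ δ) := by
  let K : Set (ℝ × ℝ) := {q | y ≤ q.2 ∧ q.1 < z}
  -- The potential is constant until the maximum reaches `y`. At the crossing step the position
  -- itself is at least `y`, so switching to its power does not raise `V`.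
  let V : ℝ × ℝ → ENNReal := fun q =>
    if y ≤ q.2 then ENNReal.ofReal (q.1 ^ (-δ)) else ENNReal.ofReal (y ^ (-δ))
  have hK : MeasurableSet K := (measurableSet_le measurable_const measurable_snd).inter
    (measurableSet_lt measurable_fst measurable_const)
  have hV : Measurable V := Measurable.ite (measurableSet_le measurable_const measurable_snd)
    (by fun_prop) measurable_const
  have hF' : Measurable fun w : (ℝ × ℝ) × ℝ => F w.1.1 w.2 :=
    hF.comp (measurable_fst.fst.prodMk measurable_snd)
  have hW : Measurable (Function.uncurry (withMax F)) :=
    hF'.prodMk (measurable_fst.snd.max hF')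
  have hΦ := measurable_stopOn hK hW
  have hdr : ∀ q ∈ {q : ℝ × ℝ | A < q.1}, ∫⁻ a, V (stopOn K (withMax F) q a) ∂μ ≤ V q + 0 := by
    rintro ⟨x, M⟩ hx
    simp only [mem_ofPred_eq] at hx
    rw [add_zero]
    by_cases hqK : (x, M) ∈ K
    · simp [stopOn, hqK]
    simp only [stopOn, hqK, if_false, withMax, V]
    by_cases hM : y ≤ M
    · simp only [le_max_iff, hM, true_or, if_true]
      exact hdrift x hx
    · simp only [hM, if_false]
      calc _ ≤ ∫⁻ _, ENNReal.ofReal (y ^ (-δ)) ∂μ := by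
            refine lintegral_mono fun a => ?_
            split_ifs with h
            · have h' : y ≤ F x a := (le_max_iff.1 h).resolve_left hM
              exact ENNReal.ofReal_le_ofReal (Real.rpow_le_rpow_of_nonpos hy h' (by linarith))
            · exact le_rfl
        _ = _ := by simp
  have hstart : V (x₀, x₀) ≤ ENNReal.ofReal (y ^ (-δ)) := by
    simp only [V]
    split_ifs with h
    · exact ENNReal.ofReal_le_ofReal (Real.rpow_le_rpow_of_nonpos hy h (by linarith))
    · exact le_rfl
  have hGW : ∀ q ∈ {q : ℝ × ℝ | A < q.1}, ∀ a, stopOn K (withMax F) q a ∈ {q : ℝ × ℝ | A < q.1} :=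
    stopOn_mem fun q hq a => hFA q.1 hq a
  have hstep : ∀ n, P {ω | ∃ m ≤ n, y ≤ runningMax (driven F x₀ (fun k => α k ω)) m ∧
      driven F x₀ (fun k => α k ω) m < z} ≤ ENNReal.ofReal ((z / y) ^ δ) := by
    intro n
    have hE := lintegral_driven_le (s₀ := (x₀, x₀)) hm hind hlaw hΦ hV hx₀ hGW hdr n
    have hzδ : 0 < z ^ (-δ) := Real.rpow_pos_of_pos hz _
    have e : (z / y) ^ δ = y ^ (-δ) / z ^ (-δ) := by
      rw [Real.div_rpow hz.le hy.le, Real.rpow_neg hy.le, Real.rpow_neg hz.le, inv_div_inv]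
    rw [e, ENNReal.ofReal_div_of_pos hzδ, ENNReal.le_div_iff_mul_le
      (Or.inl (by simpa using hzδ)) (Or.inl (by simp)), mul_comm]
    calc _ ≤ ENNReal.ofReal (z ^ (-δ)) * P {ω | ENNReal.ofReal (z ^ (-δ)) ≤
          V (driven (stopOn K (withMax F)) (x₀, x₀) (fun k => α k ω) n)} := by
          refine mul_le_mul' le_rfl (measure_mono ?_)
          rintro ω ⟨m, hmn, h⟩
          have hmem : driven (stopOn K (withMax F)) (x₀, x₀) (fun k => α k ω) n ∈ K :=
            driven_stopOn_mem_iff.2 ⟨m, hmn, by rw [driven_withMax]; exact h⟩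
          have hpos := driven_mem (s₀ := (x₀, x₀)) hx₀ hGW (fun k => α k ω) n
          simp only [V, mem_ofPred_eq]
          rw [if_pos hmem.1]
          exact ENNReal.ofReal_le_ofReal (Real.rpow_le_rpow_of_nonpos (hA.trans hpos) hmem.2.le
            (by linarith))
      _ ≤ _ := mul_meas_ge_le_lintegral (hV.comp (measurable_driven_comp hm hΦ n)) _
      _ ≤ _ := hE
      _ ≤ _ := by simpa using hstart
  -- The bound does not depend on the time horizon, so it survives the increasing union.
  have hU : {ω | ∃ m, y ≤ runningMax (driven F x₀ (fun k => α k ω)) m ∧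
      driven F x₀ (fun k => α k ω) m < z} =
      ⋃ n, {ω | ∃ m ≤ n, y ≤ runningMax (driven F x₀ (fun k => α k ω)) m ∧
      driven F x₀ (fun k => α k ω) m < z} := by
    ext ω
    simp only [mem_ofPred_eq, mem_iUnion]
    exact ⟨fun ⟨m, h⟩ => ⟨m, m, le_rfl, h⟩, fun ⟨_, m, _, h⟩ => ⟨m, h⟩⟩
  have hmono : Monotone fun n => {ω | ∃ m ≤ n, y ≤ runningMax (driven F x₀ (fun k => α k ω)) m ∧
      driven F x₀ (fun k => α k ω) m < z} :=
    fun n n' hn ω ⟨m, hmn, h⟩ => ⟨m, hmn.trans hn, h⟩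
  rw [hU, hmono.measure_iUnion]
  exact iSup_le hstep

end Maximal

/-! ### Almost sure bounds along dyadic times -/

theorem tendsto_natLog_two : Tendsto (Nat.log 2) atTop atTop := by
  refine tendsto_atTop.2 fun b => ?_
  filter_upwards [eventually_ge_atTop (2 ^ b)] with n hn
  exact Nat.le_log_of_pow_le (by norm_num) hn

theorem natLog_two_bounds {n : ℕ} (hn : 2 ≤ n) :
    2 ^ Nat.log 2 n ≤ n ∧ n ≤ 2 ^ (Nat.log 2 n + 1) ∧ (2 : ℝ) ^ Nat.log 2 n ≤ n ∧
      (n : ℝ) ≤ 2 ^ (Nat.log 2 n + 1) ∧ 0 < Nat.log 2 n * Real.log 2 ∧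
      Nat.log 2 n * Real.log 2 ≤ Real.log n := by
  have h1 : 2 ^ Nat.log 2 n ≤ n := Nat.pow_log_le_self 2 (by omega)
  have h2 : n ≤ 2 ^ (Nat.log 2 n + 1) := (Nat.lt_pow_succ_log_self (by norm_num) n).le
  have h1' : (2 : ℝ) ^ Nat.log 2 n ≤ n := by exact_mod_cast h1
  have hk : 0 < Nat.log 2 n := Nat.log_pos (by norm_num) hn
  have hk' : (0 : ℝ) < Nat.log 2 n := by exact_mod_cast hk
  refine ⟨h1, h2, h1', by exact_mod_cast h2, mul_pos hk' (Real.log_pos (by norm_num)), ?_⟩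
  rw [← Real.log_pow]
  exact Real.log_le_log (by positivity) h1'

theorem summable_mul_log_two_rpow {q : ℝ} (hq : 1 < q) :
    Summable fun k : ℕ => ((k : ℝ) * Real.log 2) ^ (-q) := by
  have h := (Real.summable_nat_rpow_inv.2 hq).mul_right (Real.log 2 ^ (-q))
  refine h.congr fun k => ?_
  rw [Real.mul_rpow (Nat.cast_nonneg k) (Real.log_nonneg (by norm_num)),
    Real.rpow_neg (Nat.cast_nonneg k)]

/-- Borel–Cantelli from index `1`: at `k = 0` the thresholds degenerate because `k log 2 = 0`. -/
theorem ae_eventually_notMem_of_summable {Ω : Type*} [MeasurableSpace Ω] {P : Measure Ω}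
    {E : ℕ → Set Ω} {u : ℕ → ℝ} (hu : Summable u)
    (h : ∀ k, 1 ≤ k → P (E k) ≤ ENNReal.ofReal (u k)) :
    ∀ᵐ ω ∂P, ∀ᶠ k in atTop, ω ∉ E k := by
  have hs : Summable fun k => u (k + 1) := (summable_nat_add_iff 1).2 hu
  have hE : ∑' k, P (E (k + 1)) ≠ ⊤ :=
    ne_top_of_le_ne_top hs.tsum_ofReal_ne_top (ENNReal.tsum_le_tsum fun k => h _ (by omega))
  filter_upwards [ae_eventually_notMem hE] with ω hω
  obtain ⟨N, hN⟩ := eventually_atTop.1 hω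
  filter_upwards [eventually_ge_atTop (N + 1)] with k hk
  have := hN (k - 1) (by omega)
  rwa [Nat.sub_add_cancel (by omega)] at this

section Almost

variable {Ω : Type*} [MeasurableSpace Ω] {P : Measure Ω} [IsProbabilityMeasure P]
  {μ : Measure ℝ} [IsProbabilityMeasure μ] {α : ℕ → Ω → ℝ} {F : ℝ → ℝ → ℝ} {A x₀ p : ℝ}

theorem ae_runningMax_le (hm : ∀ k, Measurable (α k)) (hind : iIndepFun α P)
    (hlaw : ∀ k, P.map (α k) = μ) (hF : Measurable (Function.uncurry F)) (hp : 0 < p)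
    (hA : 0 < A) (hx₀ : A < x₀) (hFA : ∀ x, A < x → ∀ a, A < F x a) {C : ℝ} (hC : 0 ≤ C)
    (hdrift : ∀ x, A < x →
      ∫⁻ a, ENNReal.ofReal (F x a ^ p) ∂μ ≤ ENNReal.ofReal (x ^ p) + ENNReal.ofReal C)
    {ε : ℝ} (hε : 0 < ε) :
    ∀ᵐ ω ∂P, ∀ᶠ n : ℕ in atTop, runningMax (driven F x₀ (fun k => α k ω)) n ≤
      (n : ℝ) ^ (1 / p) * Real.log n ^ (1 / p + ε) := by
  have hq : 1 < 1 + ε * p := by have := mul_pos hε hp; linarith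
  -- The `p`-th root turns the exponent `q` of the logarithm into `q / p = 1 / p + ε`, while `q > 1`
  -- gives summability.
  set q := 1 + ε * p with hqdef
  have hx₀p : 0 ≤ x₀ ^ p := Real.rpow_nonneg (hA.trans hx₀).le _
  have hae := ae_eventually_notMem_of_summable (P := P)
    (E := fun k => {ω | ∃ m ≤ 2 ^ (k + 1),
      (2 : ℝ) ^ k * (k * Real.log 2) ^ q ≤ driven F x₀ (fun k => α k ω) m ^ p})
    ((summable_mul_log_two_rpow hq).mul_left (x₀ ^ p + 2 * C)) (fun k hk => by
      have hl : 0 < k * Real.log 2 := mul_pos (by exact_mod_cast hk) (Real.log_pos (by norm_num))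
      have hlq : 0 < (k * Real.log 2) ^ q := Real.rpow_pos_of_pos hl _
      refine (measure_exists_le_rpow hm hind hlaw hF hA hx₀ hFA hC hdrift
        (by positivity) (2 ^ (k + 1))).trans (ENNReal.ofReal_le_ofReal ?_)
      rw [Real.rpow_neg hl.le, ← div_eq_mul_inv, div_le_div_iff₀ (by positivity) hlq]
      have h2 : (1 : ℝ) ≤ 2 ^ k := one_le_pow₀ (by norm_num)
      push_cast
      have : x₀ ^ p + 2 ^ (k + 1) * C ≤ (x₀ ^ p + 2 * C) * 2 ^ k := by
        rw [pow_succ]; nlinarith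
      calc _ ≤ (x₀ ^ p + 2 * C) * 2 ^ k * (k * Real.log 2) ^ q := by gcongr
        _ = _ := by ring)
  filter_upwards [hae] with ω hω
  filter_upwards [tendsto_natLog_two.eventually hω, eventually_ge_atTop 2] with n hn hn2
  obtain ⟨-, h2, h3, -, h5, h6⟩ := natLog_two_bounds hn2
  obtain ⟨m, hmn, hmax⟩ := exists_eq_runningMax (driven F x₀ (fun k => α k ω)) n
  have hX : A < driven F x₀ (fun k => α k ω) m :=
    driven_mem (G := Ioi A) hx₀ hFA _ m
  have hX0 := hA.trans hX
  rw [hmax]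
  have hlt : driven F x₀ (fun k => α k ω) m ^ p ≤ n * Real.log n ^ q := by
    refine (not_le.1 fun h => hn ⟨m, hmn.trans h2, h⟩).le.trans ?_
    gcongr
  have hlog : 0 ≤ Real.log n := h5.le.trans h6
  calc driven F x₀ (fun k => α k ω) m = (driven F x₀ (fun k => α k ω) m ^ p) ^ (1 / p) := by
        rw [one_div, Real.rpow_rpow_inv hX0.le hp.ne']
    _ ≤ (n * Real.log n ^ q) ^ (1 / p) :=
        Real.rpow_le_rpow (Real.rpow_nonneg hX0.le _) hlt (by positivity)
    _ = _ := by
        rw [Real.mul_rpow (Nat.cast_nonneg n) (Real.rpow_nonneg hlog _), ← Real.rpow_mul hlog]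
        congr 2
        rw [hqdef]; field_simp

/-- The level carries `2 ^ (k + 1)` and the time `2 ^ k`, so that for `2 ^ k ≤ n ≤ 2 ^ (k + 1)` the
level dominates `n` and the time precedes it. The starting value contributes a geometric series. -/
theorem ae_dyadic_le_rpow (hm : ∀ k, Measurable (α k)) (hind : iIndepFun α P)
    (hlaw : ∀ k, P.map (α k) = μ) (hF : Measurable (Function.uncurry F)) (hp : 0 < p)
    (hA : 0 < A) (hx₀ : A < x₀) (hFA : ∀ x, A < x → ∀ a, A < F x a)
    (hF2 : ∀ x, A < x → ∀ a, F x a ≤ 2 * x) {c : ℝ} (hc : 0 < c)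
    (hdrift : ∀ x, A < x →
      ENNReal.ofReal (x ^ p) + ENNReal.ofReal c ≤ ∫⁻ a, ENNReal.ofReal (F x a ^ p) ∂μ)
    {q : ℝ} (hq : 1 < q) :
    ∀ᵐ ω ∂P, ∀ᶠ k : ℕ in atTop, ∃ m ≤ 2 ^ k,
      (2 : ℝ) ^ (k + 1) * (k * Real.log 2) ^ (-q) ≤ driven F x₀ (fun k => α k ω) m ^ p := by
  have hae := ae_eventually_notMem_of_summable (P := P)
    (E := fun k => {ω | ∀ m ≤ 2 ^ k,
      driven F x₀ (fun k => α k ω) m ^ p < (2 : ℝ) ^ (k + 1) * (k * Real.log 2) ^ (-q)})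
    (((summable_geometric_of_lt_one (r := (1 / 2 : ℝ)) (by norm_num) (by norm_num)).mul_left
      (x₀ ^ p / c)).add ((summable_mul_log_two_rpow hq).mul_left (2 * 2 ^ p / c))) (fun k hk => by
      have hl : 0 < k * Real.log 2 := mul_pos (by exact_mod_cast hk) (Real.log_pos (by norm_num))
      have hlq : 0 < (k * Real.log 2) ^ (-q) := Real.rpow_pos_of_pos hl _
      refine (measure_forall_rpow_lt hm hind hlaw hF hp hA hx₀ hFA hF2 hc hdrift
        (by positivity) (by positivity : 0 < 2 ^ k)).trans (ENNReal.ofReal_le_ofReal (le_of_eq ?_))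
      push_cast
      rw [one_div, inv_pow, pow_succ]
      field_simp)
  filter_upwards [hae] with ω hω
  filter_upwards [hω] with k hk
  by_contra! h
  exact hk h

theorem ae_le_runningMax (hm : ∀ k, Measurable (α k)) (hind : iIndepFun α P)
    (hlaw : ∀ k, P.map (α k) = μ) (hF : Measurable (Function.uncurry F)) (hp : 0 < p)
    (hA : 0 < A) (hx₀ : A < x₀) (hFA : ∀ x, A < x → ∀ a, A < F x a)
    (hF2 : ∀ x, A < x → ∀ a, F x a ≤ 2 * x) {c : ℝ} (hc : 0 < c)
    (hdrift : ∀ x, A < x →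
      ENNReal.ofReal (x ^ p) + ENNReal.ofReal c ≤ ∫⁻ a, ENNReal.ofReal (F x a ^ p) ∂μ)
    {ε : ℝ} (hε : 0 < ε) :
    ∀ᵐ ω ∂P, ∀ᶠ n : ℕ in atTop, (n : ℝ) ^ (1 / p) * Real.log n ^ (-(1 / p) - ε) ≤
      runningMax (driven F x₀ (fun k => α k ω)) n := by
  have hq : 1 < 1 + ε * p := by have := mul_pos hε hp; linarith
  filter_upwards [ae_dyadic_le_rpow hm hind hlaw hF hp hA hx₀ hFA hF2 hc hdrift hq] with ω hω
  filter_upwards [tendsto_natLog_two.eventually hω, eventually_ge_atTop 2] with n hn hn2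
  obtain ⟨h1, -, -, h4, h5, h6⟩ := natLog_two_bounds hn2
  obtain ⟨m, hmk, hm'⟩ := hn
  have hX : A < driven F x₀ (fun k => α k ω) m :=
    driven_mem (G := Ioi A) hx₀ hFA _ m
  have hX0 := hA.trans hX
  refine le_trans ?_ (le_runningMax _ (hmk.trans h1))
  have hlog : 0 < Real.log n := h5.trans_le h6
  calc (n : ℝ) ^ (1 / p) * Real.log n ^ (-(1 / p) - ε)
      = (n * Real.log n ^ (-(1 + ε * p))) ^ (1 / p) := by
        rw [Real.mul_rpow (Nat.cast_nonneg n) (Real.rpow_nonneg hlog.le _),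
          ← Real.rpow_mul hlog.le]
        congr 2
        field_simp
        ring
    _ ≤ (driven F x₀ (fun k => α k ω) m ^ p) ^ (1 / p) := by
        refine Real.rpow_le_rpow (by positivity) (le_trans ?_ hm') (by positivity)
        have := Real.rpow_le_rpow_of_nonpos h5 h6 (by linarith : -(1 + ε * p) ≤ 0)
        gcongr
    _ = _ := by rw [one_div, Real.rpow_rpow_inv hX0.le hp.ne']

theorem ae_le_of_supermartingale (hm : ∀ k, Measurable (α k)) (hind : iIndepFun α P)
    (hlaw : ∀ k, P.map (α k) = μ) (hF : Measurable (Function.uncurry F)) (hp : 0 < p)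
    (hA : 0 < A) (hx₀ : A < x₀) (hFA : ∀ x, A < x → ∀ a, A < F x a)
    (hF2 : ∀ x, A < x → ∀ a, F x a ≤ 2 * x) {c : ℝ} (hc : 0 < c)
    (hdrift : ∀ x, A < x →
      ENNReal.ofReal (x ^ p) + ENNReal.ofReal c ≤ ∫⁻ a, ENNReal.ofReal (F x a ^ p) ∂μ)
    {δ : ℝ} (hδ : 0 < δ)
    (hsuper : ∀ x, A < x →
      ∫⁻ a, ENNReal.ofReal (F x a ^ (-δ)) ∂μ ≤ ENNReal.ofReal (x ^ (-δ))) :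
    ∀ᵐ ω ∂P, ∀ᶠ n : ℕ in atTop, (n : ℝ) ^ (1 / p) * Real.log n ^ (-(2 / p + 2 / δ)) ≤
      driven F x₀ (fun k => α k ω) n := by
  -- The level `Y k` is eventually reached by time `2 ^ k` (the dyadic bound with `q = 2`). A later
  -- drop by the factor `(k log 2) ^ (-(2 / δ))` has probability at most `(k log 2) ^ (-2)`, which
  -- is summable.
  let Y : ℕ → ℝ := fun k => ((2 : ℝ) ^ (k + 1) * (k * Real.log 2) ^ (-2 : ℝ)) ^ (1 / p)
  have hY : ∀ k : ℕ, 0 < k * Real.log 2 → 0 < Y k := fun k hk =>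
    Real.rpow_pos_of_pos (mul_pos (by positivity) (Real.rpow_pos_of_pos hk _)) _
  have hae := ae_eventually_notMem_of_summable (P := P)
    (E := fun k => {ω | ∃ m, Y k ≤ runningMax (driven F x₀ (fun k => α k ω)) m ∧
      driven F x₀ (fun k => α k ω) m < Y k * (k * Real.log 2) ^ (-(2 / δ))})
    (summable_mul_log_two_rpow (q := 2) (by norm_num)) (fun k hk => by
      have hl : 0 < k * Real.log 2 := mul_pos (by exact_mod_cast hk) (Real.log_pos (by norm_num))
      have hYk := hY k hl
      have hlq : 0 < (k * Real.log 2) ^ (-(2 / δ)) := Real.rpow_pos_of_pos hl _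
      refine (measure_exists_drop hm hind hlaw hF hA hx₀ hFA hδ hsuper hYk
        (mul_pos hYk hlq)).trans (ENNReal.ofReal_le_ofReal (le_of_eq ?_))
      rw [mul_div_cancel_left₀ _ hYk.ne', ← Real.rpow_mul hl.le]
      congr 1
      field_simp)
  filter_upwards [hae, ae_dyadic_le_rpow hm hind hlaw hF hp hA hx₀ hFA hF2 hc hdrift
    (q := 2) (by norm_num)] with ω hω₁ hω₂
  filter_upwards [tendsto_natLog_two.eventually hω₁, tendsto_natLog_two.eventually hω₂,
    eventually_ge_atTop 2] with n hn₁ hn₂ hn2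
  obtain ⟨h1, -, -, h4, h5, h6⟩ := natLog_two_bounds hn2
  obtain ⟨m, hmk, hm'⟩ := hn₂
  have hX : A < driven F x₀ (fun k => α k ω) m :=
    driven_mem (G := Ioi A) hx₀ hFA _ m
  have hX0 := hA.trans hX
  have hlog : 0 < Real.log n := h5.trans_le h6
  have hYmax : Y (Nat.log 2 n) ≤ runningMax (driven F x₀ (fun k => α k ω)) n := by
    refine le_trans ?_ (le_runningMax _ (hmk.trans h1))
    calc Y (Nat.log 2 n) ≤ (driven F x₀ (fun k => α k ω) m ^ p) ^ (1 / p) :=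
          Real.rpow_le_rpow (by positivity) hm' (by positivity)
      _ = _ := by rw [one_div, Real.rpow_rpow_inv hX0.le hp.ne']
  have hYlow : (n : ℝ) ^ (1 / p) * Real.log n ^ (-(2 / p)) ≤ Y (Nat.log 2 n) := by
    calc (n : ℝ) ^ (1 / p) * Real.log n ^ (-(2 / p))
        = (n * Real.log n ^ (-2 : ℝ)) ^ (1 / p) := by
          rw [Real.mul_rpow (Nat.cast_nonneg n) (Real.rpow_nonneg hlog.le _),
            ← Real.rpow_mul hlog.le]
          congr 2
          ring
      _ ≤ Y (Nat.log 2 n) := by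
          refine Real.rpow_le_rpow (by positivity) ?_ (by positivity)
          have := Real.rpow_le_rpow_of_nonpos h5 h6 (by norm_num : (-2 : ℝ) ≤ 0)
          gcongr
  have hlow := Real.rpow_le_rpow_of_nonpos h5 h6 (by
    rw [neg_nonpos]; positivity : -(2 / δ) ≤ 0)
  calc (n : ℝ) ^ (1 / p) * Real.log n ^ (-(2 / p + 2 / δ))
      = (n : ℝ) ^ (1 / p) * Real.log n ^ (-(2 / p)) * Real.log n ^ (-(2 / δ)) := by
        rw [neg_add, Real.rpow_add hlog]; ring
    _ ≤ Y (Nat.log 2 n) * (Nat.log 2 n * Real.log 2) ^ (-(2 / δ)) :=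
        mul_le_mul hYlow hlow (Real.rpow_nonneg hlog.le _) (hY _ h5).le
    _ ≤ _ := not_lt.1 fun h => hn₁ ⟨n, hYmax, h⟩

end Almost

/-- As long as the angles stay below `α₀`, the collisions process in a thin tube stays finite and
its first coordinate is the horizontal chain. -/
theorem collisions_eq {γ A α₀ : ℝ} (hA : 0 < A)
    (hstep : ∀ (p : ℝ × ℝ) (a : ℝ), A < p.1 → |p.2| = p.1 ^ γ → |a| < α₀ →
      ∃ q : ℝ × ℝ, step (fun x => x ^ γ) A p a = some q ∧
        q.1 = hstep γ A p.1 a ∧ |q.2| = q.1 ^ γ)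
    {p₀ : ℝ × ℝ} (hp₀ : A < p₀.1) (hp₀' : |p₀.2| = p₀.1 ^ γ) {a : ℕ → ℝ} (ha : ∀ k, |a k| < α₀)
    (n : ℕ) :
    ∃ q : ℝ × ℝ, collisions (fun x => x ^ γ) A p₀ a n = some q ∧
      q.1 = driven (StochasticBilliard.hstep γ A) p₀.1 a n ∧ A < q.1 ∧ |q.2| = q.1 ^ γ := by
  induction n with
  | zero => exact ⟨p₀, rfl, rfl, hp₀, hp₀'⟩
  | succ n ih =>
    obtain ⟨q, hq, hq1, hqA, hq2⟩ := ih
    obtain ⟨r, hr, hr1, hr2⟩ := hstep q (a n) hqA hq2 (ha n)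
    refine ⟨r, ?_, ?_, ?_, hr2⟩
    · rw [collisions, hq]; exact hr
    · rw [hr1, hq1, driven]
    · rw [hr1]; exact lt_hstep hA

end StochasticBilliard

end

/-! ### The growth theorem for the collisions process -/

theorem mainTheorem3 (γ : ℝ) (hγ₀ : 0 < γ) (hγ₁ : γ < 1)
    (μ : Measure ℝ) [IsProbabilityMeasure μ]
    (α₀ : ℝ) (hα₀ : α₀ ∈ Set.Ioo 0 (Real.pi / 2))
    (hbound : ∀ᵐ a ∂μ, |a| < α₀)
    (hsymm : ∀ x : ℝ, μ (Set.Ici x) = μ (Set.Iic (-x))) :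
    ∃ A₀ : ℝ, 1 ≤ A₀ ∧ ∀ A : ℝ, A₀ < A →
      ∀ p₀ ∈ frontier (StochasticBilliard.tube (fun x => x ^ γ) A), 2 * A < p₀.1 →
      ∃ D : ℝ, 0 < D ∧
      ∀ (Ω : Type*) [MeasurableSpace Ω] (P : Measure Ω) [IsProbabilityMeasure P]
        (α : ℕ → Ω → ℝ), (∀ k, Measurable (α k)) → iIndepFun α P →
        (∀ k, P.map (α k) = μ) →
        ∀ ξ : ℕ → Ω → Option (ℝ × ℝ),
        (∀ n ω, ξ n ω =
          StochasticBilliard.collisions (fun x => x ^ γ) A p₀ (fun k => α k ω) n) →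
        (∀ᵐ ω ∂P, ∀ n, ξ n ω ≠ none) ∧
        (∀ ε : ℝ, 0 < ε → ∀ᵐ ω ∂P, ∀ᶠ n : ℕ in atTop,
          StochasticBilliard.runningMax (fun m => StochasticBilliard.horizontal (ξ m ω)) n ≤
            (n : ℝ) ^ (1 / (2 * (1 - γ))) * Real.log n ^ (1 / (2 * (1 - γ)) + ε) ∧
          (n : ℝ) ^ (1 / (2 * (1 - γ))) * Real.log n ^ (-(1 / (2 * (1 - γ))) - ε) ≤
            StochasticBilliard.runningMax (fun m => StochasticBilliard.horizontal (ξ m ω)) n) ∧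
        (StochasticBilliard.criticalExponent μ < γ →
          ∀ᵐ ω ∂P, ∀ᶠ n : ℕ in atTop,
            (n : ℝ) ^ (1 / (2 * (1 - γ))) * Real.log n ^ (-D) ≤
              StochasticBilliard.horizontal (ξ n ω)) := by
  obtain ⟨A₁, hA₁, hgeom⟩ := StochasticBilliard.step_eq hγ₀ hγ₁ hα₀
  obtain ⟨A₂, c, C, hA₂, hc, hC, hlin⟩ :=
    StochasticBilliard.drift_linear hγ₀ hγ₁ hα₀ hbound hsymm
  -- Both `A₀` and `D` are fixed before the supercriticality assumption appears, so `δ` must exist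
  -- in every case; its value is a dummy when `γ` is not supercritical.
  obtain ⟨A₃, δ, hδ, hsup⟩ : ∃ A₃ δ : ℝ, 0 < δ ∧
      (StochasticBilliard.criticalExponent μ < γ → ∀ A x : ℝ, A₃ ≤ A → A < x →
        ∫⁻ a, ENNReal.ofReal (StochasticBilliard.hstep γ A x a ^ (-δ)) ∂μ ≤
          ENNReal.ofReal (x ^ (-δ))) := by
    by_cases hcrit : StochasticBilliard.criticalExponent μ < γ
    · obtain ⟨A₃, δ, -, hδ, h⟩ :=
        StochasticBilliard.drift_supermartingale hγ₀ hγ₁ hα₀ hbound hsymm hcrit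
      exact ⟨A₃, δ, hδ, fun _ => h⟩
    · exact ⟨1, 1, one_pos, fun h => absurd h hcrit⟩
  refine ⟨max A₁ (max A₂ A₃), hA₁.trans (le_max_left _ _), fun A hA p₀ hp₀ hp₀A => ?_⟩
  have hA₁' : A₁ ≤ A := (le_max_left _ _).trans hA.le
  have hA₂' : A₂ ≤ A := (le_max_left _ _).trans ((le_max_right _ _).trans hA.le)
  have hA₃' : A₃ ≤ A := (le_max_right _ _).trans ((le_max_right _ _).trans hA.le)
  have hA0 : 0 < A := by linarith
  have hx₀ : A < p₀.1 := by linarith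
  have hp₀' := StochasticBilliard.abs_snd_eq_of_mem_frontier hγ₀ hp₀ hx₀
  have hp : 0 < 2 * (1 - γ) := by linarith
  refine ⟨2 / (2 * (1 - γ)) + 2 / δ, by positivity, ?_⟩
  intro Ω _ P _ α hm hind hlaw ξ hξ
  have hall : ∀ᵐ ω ∂P, ∀ k, |α k ω| < α₀ := by
    refine ae_all_iff.2 fun k => ?_
    rw [← hlaw k] at hbound
    exact ae_of_ae_map (hm k).aemeasurable hbound
  have hkey : ∀ ω, (∀ k, |α k ω| < α₀) → ∀ n, ξ n ω ≠ none ∧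
      StochasticBilliard.horizontal (ξ n ω) =
        StochasticBilliard.driven (StochasticBilliard.hstep γ A) p₀.1 (fun k => α k ω) n := by
    intro ω hω n
    obtain ⟨q, hq, hq1, -⟩ := StochasticBilliard.collisions_eq hA0
      (fun p a h1 h2 h3 => hgeom A p a hA₁' h1 h2 h3) hx₀ hp₀' hω n
    rw [hξ, hq]
    exact ⟨Option.some_ne_none _, hq1⟩
  have hF : Measurable (Function.uncurry (StochasticBilliard.hstep γ A)) :=
    StochasticBilliard.measurable_hstep γ A
  have hFA : ∀ x, A < x → ∀ a, A < StochasticBilliard.hstep γ A x a :=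
    fun _ _ _ => StochasticBilliard.lt_hstep hA0
  have hF2 : ∀ x, A < x → ∀ a, StochasticBilliard.hstep γ A x a ≤ 2 * x :=
    fun _ hx _ => StochasticBilliard.hstep_le hA0 hx
  have hlow := fun x hx => (hlin A x hA₂' hx).1
  refine ⟨?_, fun ε hε => ?_, fun hcrit => ?_⟩
  · filter_upwards [hall] with ω hω n using (hkey ω hω n).1
  · filter_upwards [hall,
      StochasticBilliard.ae_runningMax_le hm hind hlaw hF hp hA0 hx₀ hFA
        (add_nonneg hC.le (Real.rpow_nonneg (by linarith) _))
        (fun x hx => (hlin A x hA₂' hx).2) hε,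
      StochasticBilliard.ae_le_runningMax hm hind hlaw hF hp hA0 hx₀ hFA hF2 hc hlow hε]
      with ω hω hU hL
    have e : (fun m => StochasticBilliard.horizontal (ξ m ω)) =
        StochasticBilliard.driven (StochasticBilliard.hstep γ A) p₀.1 (fun k => α k ω) :=
      funext fun m => (hkey ω hω m).2
    rw [e]
    exact hU.and hL
  · filter_upwards [hall,
      StochasticBilliard.ae_le_of_supermartingale hm hind hlaw hF hp hA0 hx₀ hFA hF2 hc hlow hδ
        (fun x hx => hsup hcrit A x hA₃' hx)] with ω hω hT
    filter_upwards [hT] with n hn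
    rw [(hkey ω hω n).2]
    exact hn
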